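/- **Setting.** Let $\mathfrak h$ and $\mathsf k$ be complex Hilbert spaces (inner products are linear in the second argument). For an interval $I\subset\mathbb R_+=[0,\infty)$ let $\mathcal F_I$ be the symmetric Fock space over $L^2(I;\mathsf k)$, put $\mathcal F_+=\mathcal F_{\mathbb R_+}$, and for $f\in L^2(I;\mathsf k)$ let $\varepsilon(f)=(1,f,(2!)^{-1/2}f\otimes f,\ldots)\in\mathcal F_I$ be the exponential vector. For $t\ge 0$ identify $\mathcal F_+\cong\mathcal F_{[0,t)}\otimes\mathcal F_{[t,\infty)}$ via $\varepsilon(f)\leftrightarrow\varepsilon(f|_{[0,t)})\otimes\varepsilon(f|_{[t,\infty)})$. Let $(s_t f)(u)=f(u-t)$ for $u\ge t$ and $0$ for $u<t$, and let $\sigma_t$ be the endomorphism of $B(\mathfrak h\otimes\mathcal F_+)$ determined by $$\langle u\otimes\varepsilon(f),\sigma_t(T)\,v\otimes\varepsilon(g)\rangle=\langle u\otimes\varepsilon(s_t^*f),T\,v\otimes\varepsilon(s_t^*g)\rangle\,\exp\int_0^t\langle f(u),g(u)\rangle\,du .$$ Let $R_t$ be the self-adjoint unitary on $\mathfrak h\otimes\mathcal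 F_+$ with $R_t(u\otimes\varepsilon(f))=u\otimes\varepsilon(r_tf)$, where $(r_tf)(u)=f(t-u)$ for $u\le t$ and $(r_tf)(u)=f(u)$ for $u>t$. A *left cocycle* (respectively *right cocycle*) is a family $X=(X_t)_{t\ge0}$ in $B(\mathfrak h\otimes\mathcal F_+)$ such that $X_t\in B(\mathfrak h\otimes\mathcal F_{[0,t)})\otimes I_{\mathcal F_{[t,\infty)}}$ for all $t\geq 0$, $X_0=I$, and $X_{r+t}=X_r\,\sigma_r(X_t)$ (respectively $X_{r+t}=\sigma_r(X_t)\,X_r$) for all $r,t\ge0$. No continuity in $t$ is assumed. Put $X^*=(X_t^*)_{t\ge0}$ and $\widetilde X=(R_tX_tR_t)_{t\ge0}$. For a vector $x \in \mathcal F_+$ let $E_x:\mathfrak h\to\mathfrak h\otimes\mathcal F_+$, $u\mapsto u\otimes x$, let $E^x=(E_x)^*$, and for $c,d\in\mathsf k$, $t\ge0$ put $$Q^{c,d}_t=E^{\varepsilon(c\mathbf 1_{[0,t)})}\,X_t\,E_{\varepsilon(d\mathbf 1_{[0,t)})}\in B(\mathfrak h).$$ Let $\mathcal A_X$ be the norm-closed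 unital subalgebra of $B(\mathfrak h)$ generated by all $Q^{c,d}_t$ ($c,d\in\mathsf k$, $t\ge0$), and $\mathcal M_X$ the von Neumann algebra generated by $\mathcal A_X$. **Proposition 2.4.** Let $X$ be a left cocycle. (a) The following are equivalent: (i) $X$ is also a right cocycle; (ii) $X=\widetilde X$; (iii) $\mathcal A_X$ is commutative. (b) The following are equivalent: (i) $X^*=\widetilde X$; (ii) $(Q^{c,d}_t)^*=Q^{d,c}_t$ for all $c,d\in\mathsf k$ and $t\ge0$. In this case $\mathcal A_X$ is closed under taking adjoints. (c) The following are equivalent: (i) $X$ is self-adjoint, that is, $X_t^*=X_t$ for all $t\ge0$; (ii) $(Q^{c,d}_t)^*=Q^{d,c}_t$ for all $c,d\in\mathsf k$ and $t\ge0$, and $\mathcal M_X$ is commutative. In this case $X=\widetilde X$ as well. -/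

import Mathlib

open MeasureTheory Set UniformSpace
open scoped TensorProduct NNReal InnerProductSpace

universe u v w

namespace FockCocycle

/-- A bundled complex inner product space, used to build tensor powers by recursion. -/
structure PreHilbert : Type (u + 1) where
  carrier : Type u
  [normed : NormedAddCommGroup carrier]
  [innerProd : InnerProductSpace ℂ carrier]

attribute [instance] PreHilbert.normed PreHilbert.innerProd

section Fock

variable (H : Type u) [NormedAddCommGroup H] [InnerProductSpace ℂ H]

/-- The algebraic tensor powers `H ⊗ ⋯ ⊗ H` with their inner products; the zeroth power is `ℂ`
(as a one-dimensional space in the universe of `H`). -/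
noncomputable def tensorPowAux : ℕ → PreHilbert.{u}
  | 0 => ⟨EuclideanSpace ℂ PUnit.{u + 1}⟩
  | n + 1 => ⟨H ⊗[ℂ] (tensorPowAux n).carrier⟩

/-- The algebraic `n`-fold tensor power of `H`. -/
abbrev TensorPow (n : ℕ) : Type u := (tensorPowAux H n).carrier

variable {H} in
/-- The elementary tensor `f ⊗ ⋯ ⊗ f` (`n` factors), which is `1 ∈ ℂ` for `n = 0`. -/
noncomputable def powVec (f : H) : (n : ℕ) → TensorPow H n
  | 0 => (EuclideanSpace.single PUnit.unit 1 : EuclideanSpace ℂ PUnit.{u + 1})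
  | n + 1 => (f ⊗ₜ[ℂ] powVec f n : H ⊗[ℂ] TensorPow H n)

/-- The `n`-fold Hilbert space tensor power of `H`. -/
def HilbertPow (n : ℕ) : Type u := Completion (TensorPow H n)

noncomputable instance (n : ℕ) : NormedAddCommGroup (HilbertPow H n) :=
  inferInstanceAs (NormedAddCommGroup (Completion (TensorPow H n)))

noncomputable instance (n : ℕ) : InnerProductSpace ℂ (HilbertPow H n) :=
  inferInstanceAs (InnerProductSpace ℂ (Completion (TensorPow H n)))

instance (n : ℕ) : CompleteSpace (HilbertPow H n) :=
  inferInstanceAs (CompleteSpace (Completion (TensorPow H n)))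

variable {H} in
/-- `f ⊗ ⋯ ⊗ f` as a vector of the completed tensor power. -/
noncomputable def hilbertPowVec (f : H) (n : ℕ) : HilbertPow H n :=
  (powVec f n : Completion (TensorPow H n))

/-- The `n`-fold symmetric Hilbert space tensor power of `H`, as the closed linear span of the
vectors `f ⊗ ⋯ ⊗ f` (by polarization, these span the symmetric tensors). -/
noncomputable def symPow (n : ℕ) : Submodule ℂ (HilbertPow H n) :=
  (Submodule.span ℂ (range fun f : H => hilbertPowVec f n)).topologicalClosure

/-- Symmetric Fock space over `H`: the Hilbert space direct sum, over all `n`, of the `n`-fold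
symmetric tensor powers of `H`. -/
def Fock : Type u := lp (fun n => symPow H n) 2

noncomputable instance (n : ℕ) : CompleteSpace (symPow H n) :=
  (Submodule.isClosed_topologicalClosure _).completeSpace_coe

noncomputable instance : NormedAddCommGroup (Fock H) :=
  inferInstanceAs (NormedAddCommGroup (lp (fun n => symPow H n) 2))

noncomputable instance : InnerProductSpace ℂ (Fock H) :=
  inferInstanceAs (InnerProductSpace ℂ (lp (fun n => symPow H n) 2))

instance : CompleteSpace (Fock H) :=
  inferInstanceAs (CompleteSpace (lp (fun n => symPow H n) 2))

variable {H} in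
/-- The `n`-particle component of a Fock space vector. -/
noncomputable def Fock.comp (ξ : Fock H) (n : ℕ) : symPow H n :=
  (show lp (fun n => symPow H n) 2 from ξ) n

theorem Fock.hasSum_inner (ξ η : Fock H) :
    HasSum (fun n => ⟪ξ.comp n, η.comp n⟫_ℂ) ⟪ξ, η⟫_ℂ :=
  lp.hasSum_inner (𝕜 := ℂ) (show lp (fun n => symPow H n) 2 from ξ) η

variable {H}

theorem inner_powVec (f g : H) (n : ℕ) : ⟪powVec f n, powVec g n⟫_ℂ = ⟪f, g⟫_ℂ ^ n := by
  induction n with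
  | zero =>
    change ⟪(EuclideanSpace.single PUnit.unit 1 : EuclideanSpace ℂ PUnit.{u + 1}),
      EuclideanSpace.single PUnit.unit 1⟫_ℂ = _
    simp
  | succ n ih =>
    change ⟪(f ⊗ₜ[ℂ] powVec f n : H ⊗[ℂ] TensorPow H n), g ⊗ₜ[ℂ] powVec g n⟫_ℂ = _
    rw [TensorProduct.inner_tmul, ih, pow_succ']

theorem powVec_smul (z : ℂ) (f : H) (n : ℕ) : powVec (z • f) n = z ^ n • powVec f n := by
  induction n with
  | zero => rw [pow_zero, one_smul]; rfl
  | succ n ih =>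
    change ((z • f) ⊗ₜ[ℂ] powVec (z • f) n : H ⊗[ℂ] TensorPow H n) =
      z ^ (n + 1) • (f ⊗ₜ[ℂ] powVec f n : H ⊗[ℂ] TensorPow H n)
    rw [ih, TensorProduct.smul_tmul_smul, pow_succ']

/-- `f ⊗ ⋯ ⊗ f` as a vector of the symmetric tensor power. -/
noncomputable def symVec (f : H) (n : ℕ) : symPow H n :=
  ⟨hilbertPowVec f n,
    Submodule.le_topologicalClosure _ (Submodule.subset_span ⟨f, rfl⟩)⟩

theorem inner_symVec (f g : H) (n : ℕ) : ⟪symVec f n, symVec g n⟫_ℂ = ⟪f, g⟫_ℂ ^ n := by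
  change ⟪(powVec f n : Completion (TensorPow H n)), (powVec g n : Completion (TensorPow H n))⟫_ℂ = _
  rw [Completion.inner_coe, inner_powVec]

theorem symVec_smul (z : ℂ) (f : H) (n : ℕ) : symVec (z • f) n = z ^ n • symVec f n := by
  apply Subtype.ext
  change (powVec (z • f) n : Completion (TensorPow H n)) = z ^ n • (powVec f n : Completion (TensorPow H n))
  rw [powVec_smul, Completion.coe_smul]

theorem norm_symVec_sq (f : H) (n : ℕ) : ‖symVec f n‖ ^ 2 = (‖f‖ ^ 2) ^ n := by
  have h := inner_symVec f f n
  rw [inner_self_eq_norm_sq_to_K, inner_self_eq_norm_sq_to_K] at h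
  exact_mod_cast h

theorem memlp_expFun (f : H) :
    Memℓp (fun n => (((Real.sqrt n.factorial)⁻¹ : ℝ) : ℂ) • symVec f n) 2 := by
  apply memℓp_gen
  refine (Real.summable_pow_div_factorial (‖f‖ ^ 2)).congr fun n => ?_
  rw [norm_smul]
  rw [show (2 : ENNReal).toReal = 2 by simp, Real.rpow_ofNat, Complex.norm_real, norm_inv, Real.norm_of_nonneg (Real.sqrt_nonneg _)]
  rw [mul_pow, norm_symVec_sq, inv_pow, Real.sq_sqrt (by positivity)]
  field_simp

/-- The exponential vector `ε(f) = (1, f, (2!)^{-1/2} f ⊗ f, (3!)^{-1/2} f ⊗ f ⊗ f, …)`. -/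
noncomputable def expVec (f : H) : Fock H :=
  (⟨fun n => (((Real.sqrt n.factorial)⁻¹ : ℝ) : ℂ) • symVec f n, memlp_expFun f⟩ :
    lp (fun n => symPow H n) 2)

theorem expVec_apply (f : H) (n : ℕ) :
    (expVec f).comp n = (((Real.sqrt n.factorial)⁻¹ : ℝ) : ℂ) • symVec f n := rfl

theorem inner_expVec (f g : H) : ⟪expVec f, expVec g⟫_ℂ = Complex.exp ⟪f, g⟫_ℂ := by
  have h := Fock.hasSum_inner H (expVec f) (expVec g)
  refine h.unique ?_
  have h2 := NormedSpace.expSeries_div_hasSum_exp (𝔸 := ℂ) (⟪f, g⟫_ℂ)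
  rw [← Complex.exp_eq_exp_ℂ] at h2
  refine h2.congr_fun fun n => ?_
  rw [expVec_apply, expVec_apply, inner_smul_left, inner_smul_right, inner_symVec, Complex.conj_ofReal,
    ← mul_assoc, ← Complex.ofReal_mul, ← mul_inv, Real.mul_self_sqrt (by positivity)]
  push_cast
  field_simp


/-- The exponential vectors are total in Fock space. -/
theorem expVec_total : (Submodule.span ℂ (range (expVec : H → Fock H))).topologicalClosure = ⊤ := by
  rw [Submodule.topologicalClosure_eq_top_iff, Submodule.eq_bot_iff]
  intro ξ hξ
  rw [Submodule.mem_orthogonal'] at hξ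
  -- every component of `ξ` is orthogonal to all the powers `f ⊗ ⋯ ⊗ f`
  have key : ∀ (f : H) (n : ℕ), ⟪ξ.comp n, symVec f n⟫_ℂ = 0 := by
    intro f
    set a : ℕ → ℂ := fun n => ⟪ξ.comp n, (expVec f).comp n⟫_ℂ with ha
    have hs : ∀ z : ℂ, HasSum (fun n => z ^ n • a n) 0 := by
      intro z
      have h := Fock.hasSum_inner H ξ (expVec (z • f))
      rw [hξ _ (Submodule.subset_span ⟨_, rfl⟩)] at h
      refine h.congr_fun fun n => Eq.symm ?_
      change _ = z ^ n • ⟪ξ.comp n, (expVec f).comp n⟫_ℂ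
      rw [expVec_apply, expVec_apply, symVec_smul, smul_comm, inner_smul_right, smul_eq_mul]
    have hp : HasFPowerSeriesAt (0 : ℂ → ℂ) (FormalMultilinearSeries.ofScalars ℂ a) 0 := by
      rw [hasFPowerSeriesAt_iff]
      refine Filter.Eventually.of_forall fun z => ?_
      simpa [FormalMultilinearSeries.coeff_ofScalars] using hs z
    have h0 := hp.eq_zero
    intro n
    have hn : a n = 0 := by
      have := congrArg (fun p : FormalMultilinearSeries ℂ ℂ ℂ => p.coeff n) h0
      rw [FormalMultilinearSeries.coeff_ofScalars] at this
      exact this.trans rfl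
    rw [ha] at hn
    simp only [expVec_apply, inner_smul_right, mul_eq_zero] at hn
    refine hn.resolve_left ?_
    have : Real.sqrt n.factorial ≠ 0 := by positivity
    exact_mod_cast inv_ne_zero this
  apply lp.ext
  funext n
  -- hence it is orthogonal to their closed span
  have h1 : (ξ.comp n : HilbertPow H n) ∈
      (Submodule.span ℂ (range fun f : H => hilbertPowVec f n)).topologicalClosureᗮ := by
    rw [Submodule.orthogonal_closure, Submodule.mem_orthogonal']
    intro u hu
    induction hu using Submodule.span_induction with
    | mem x hx => obtain ⟨f, rfl⟩ := hx; exact key f n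
    | zero => simp
    | add x y _ _ hx hy => rw [inner_add_right, hx, hy, add_zero]
    | smul c x _ hx => rw [inner_smul_right, hx, mul_zero]
  have h2 : ⟪(ξ.comp n : HilbertPow H n), (ξ.comp n : HilbertPow H n)⟫_ℂ = 0 :=
    Submodule.inner_left_of_mem_orthogonal (ξ.comp n).2 h1
  exact Subtype.ext (inner_self_eq_zero.1 h2)

end Fock

section Gram

variable {ι : Type w} {A : Type u} {B : Type v}
  [NormedAddCommGroup A] [InnerProductSpace ℂ A]
  [NormedAddCommGroup B] [InnerProductSpace ℂ B]

theorem denseRange_linearCombination {a : ι → A}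
    (ha : (Submodule.span ℂ (range a)).topologicalClosure = ⊤) :
    DenseRange (Finsupp.linearCombination ℂ a) := by
  rw [DenseRange, ← LinearMap.coe_range, Finsupp.range_linearCombination]
  exact Submodule.dense_iff_topologicalClosure_eq_top.2 ha

theorem norm_linearCombination_eq {a : ι → A} {b : ι → B}
    (hab : ∀ i j, ⟪b i, b j⟫_ℂ = ⟪a i, a j⟫_ℂ) (x : ι →₀ ℂ) :
    ‖Finsupp.linearCombination ℂ b x‖ = ‖Finsupp.linearCombination ℂ a x‖ := by
  have h : ⟪Finsupp.linearCombination ℂ b x, Finsupp.linearCombination ℂ b x⟫_ℂ =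
      ⟪Finsupp.linearCombination ℂ a x, Finsupp.linearCombination ℂ a x⟫_ℂ := by
    simp only [Finsupp.linearCombination_apply, Finsupp.sum, sum_inner, inner_sum, inner_smul_left,
      inner_smul_right, hab]
  rw [inner_self_eq_norm_sq_to_K, inner_self_eq_norm_sq_to_K] at h
  have h' : ‖Finsupp.linearCombination ℂ b x‖ ^ 2 = ‖Finsupp.linearCombination ℂ a x‖ ^ 2 := by
    exact_mod_cast h
  exact (sq_eq_sq₀ (norm_nonneg _) (norm_nonneg _)).1 h'

variable [CompleteSpace A] [CompleteSpace B]

/-- The unitary carrying `a i` to `b i`, for two total families with the same Gram matrix. -/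
noncomputable def gramEquiv (a : ι → A) (b : ι → B)
    (ha : (Submodule.span ℂ (range a)).topologicalClosure = ⊤)
    (hb : (Submodule.span ℂ (range b)).topologicalClosure = ⊤)
    (hab : ∀ i j, ⟪b i, b j⟫_ℂ = ⟪a i, a j⟫_ℂ) : A ≃ₗᵢ[ℂ] B :=
  (LinearEquiv.refl ℂ (ι →₀ ℂ)).extendOfIsometry (Finsupp.linearCombination ℂ a)
    (Finsupp.linearCombination ℂ b) (denseRange_linearCombination ha)
    (denseRange_linearCombination hb) (fun x => norm_linearCombination_eq hab x)

@[simp] theorem gramEquiv_apply (a : ι → A) (b : ι → B)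
    (ha : (Submodule.span ℂ (range a)).topologicalClosure = ⊤)
    (hb : (Submodule.span ℂ (range b)).topologicalClosure = ⊤)
    (hab : ∀ i j, ⟪b i, b j⟫_ℂ = ⟪a i, a j⟫_ℂ) (i : ι) :
    gramEquiv a b ha hb hab (a i) = b i := by
  have h := LinearEquiv.extendOfIsometry_eq (f := LinearEquiv.refl ℂ (ι →₀ ℂ))
    (e₁ := Finsupp.linearCombination ℂ a)
    (e₂ := Finsupp.linearCombination ℂ b) (denseRange_linearCombination ha)
    (denseRange_linearCombination hb) (fun x => norm_linearCombination_eq hab x) (Finsupp.single i 1)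
  simp only [LinearEquiv.refl_apply, Finsupp.linearCombination_single, one_smul] at h
  exact h

end Gram

section HilbertTensor

variable (H : Type u) (K : Type v)
    [NormedAddCommGroup H] [InnerProductSpace ℂ H]
    [NormedAddCommGroup K] [InnerProductSpace ℂ K]

/-- The (completed) tensor product of Hilbert spaces. -/
def HilbertTensor : Type (max u v) := Completion (H ⊗[ℂ] K)

noncomputable instance : NormedAddCommGroup (HilbertTensor H K) :=
  inferInstanceAs (NormedAddCommGroup (Completion (H ⊗[ℂ] K)))

noncomputable instance : InnerProductSpace ℂ (HilbertTensor H K) :=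
  inferInstanceAs (InnerProductSpace ℂ (Completion (H ⊗[ℂ] K)))

instance : CompleteSpace (HilbertTensor H K) :=
  inferInstanceAs (CompleteSpace (Completion (H ⊗[ℂ] K)))

/-- The inclusion of the algebraic tensor product. -/
noncomputable def HilbertTensor.ofTensor : (H ⊗[ℂ] K) →ₗᵢ[ℂ] HilbertTensor H K :=
  (Completion.toComplₗᵢ : (H ⊗[ℂ] K) →ₗᵢ[ℂ] Completion (H ⊗[ℂ] K))

variable {H K}

/-- The elementary tensor `x ⊗ y`. -/
noncomputable def htmul (x : H) (y : K) : HilbertTensor H K :=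
  HilbertTensor.ofTensor H K (x ⊗ₜ[ℂ] y)

theorem inner_htmul (x x' : H) (y y' : K) :
    ⟪htmul x y, htmul x' y'⟫_ℂ = ⟪x, x'⟫_ℂ * ⟪y, y'⟫_ℂ := by
  rw [htmul, htmul, LinearIsometry.inner_map_map, TensorProduct.inner_tmul]

theorem denseRange_ofTensor : DenseRange (HilbertTensor.ofTensor H K) :=
  Completion.denseRange_coe (α := H ⊗[ℂ] K)

/-- The ampliation `T ⊗ I` of a bounded operator `T`. -/
noncomputable def amplify (T : H →L[ℂ] H) : HilbertTensor H K →L[ℂ] HilbertTensor H K :=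
  (ContinuousLinearMap.completion (T.rTensor K) : Completion (H ⊗[ℂ] K) →L[ℂ] Completion (H ⊗[ℂ] K))

@[simp] theorem amplify_htmul (T : H →L[ℂ] H) (x : H) (y : K) :
    amplify T (htmul x y) = htmul (T x) y :=
  ContinuousLinearMap.completion_apply_coe (T.rTensor K) (x ⊗ₜ[ℂ] y)

/-- The operator `E_y : x ↦ x ⊗ y`. -/
noncomputable def tensorRight (y : K) : H →L[ℂ] HilbertTensor H K :=
  (HilbertTensor.ofTensor H K).toContinuousLinearMap ∘L (TensorProduct.mkL ℂ H K).flip y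

@[simp] theorem tensorRight_apply (y : K) (x : H) : tensorRight y x = htmul x y := rfl

theorem htmul_total {ι κ : Type*} {a : ι → H} {b : κ → K}
    (ha : (Submodule.span ℂ (range a)).topologicalClosure = ⊤)
    (hb : (Submodule.span ℂ (range b)).topologicalClosure = ⊤) :
    (Submodule.span ℂ (range fun p : ι × κ => htmul (a p.1) (b p.2))).topologicalClosure = ⊤ := by
  set S := (Submodule.span ℂ (range fun p : ι × κ => htmul (a p.1) (b p.2))).topologicalClosure
  have hS : IsClosed (S : Set (HilbertTensor H K)) := Submodule.isClosed_topologicalClosure _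
  have hcont1 : ∀ y : K, Continuous fun x : H => htmul x y := fun y => (tensorRight (H := H) y).continuous
  have hcont2 : ∀ x : H, Continuous fun y : K => htmul x y := fun x =>
    (HilbertTensor.ofTensor H K).continuous.comp (TensorProduct.mkL ℂ H K x).continuous
  have h1 : ∀ (i : ι) (y : K), htmul (a i) y ∈ S := by
    intro i y
    have hle : (Submodule.span ℂ (range b)) ≤
        S.comap ((HilbertTensor.ofTensor H K).toLinearMap ∘ₗ TensorProduct.mk ℂ H K (a i)) := by
      rw [Submodule.span_le]
      rintro _ ⟨j, rfl⟩
      exact Submodule.le_topologicalClosure _ (Submodule.subset_span ⟨(i, j), rfl⟩)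
    have := Submodule.topologicalClosure_minimal _ hle (hS.preimage (hcont2 (a i)))
    rw [hb] at this
    exact this (Submodule.mem_top (x := y))
  have h2 : ∀ (x : H) (y : K), htmul x y ∈ S := by
    intro x y
    have hle : (Submodule.span ℂ (range a)) ≤
        S.comap ((HilbertTensor.ofTensor H K).toLinearMap ∘ₗ (TensorProduct.mk ℂ H K).flip y) := by
      rw [Submodule.span_le]
      rintro _ ⟨j, rfl⟩
      exact h1 j y
    have := Submodule.topologicalClosure_minimal _ hle (hS.preimage (hcont1 y))
    rw [ha] at this
    exact this (Submodule.mem_top (x := x))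
  have h3 : ∀ z : H ⊗[ℂ] K, HilbertTensor.ofTensor H K z ∈ S := by
    intro z
    induction z using TensorProduct.induction_on with
    | zero => rw [map_zero]; exact S.zero_mem
    | tmul x y => exact h2 x y
    | add x y hx hy => rw [map_add]; exact S.add_mem hx hy
  rw [eq_top_iff]
  intro z _
  exact denseRange_ofTensor.induction_on (p := fun z => z ∈ S) z hS h3

end HilbertTensor

section Exponential

variable {h : Type u} [NormedAddCommGroup h] [InnerProductSpace ℂ h]
  {H : Type v} [NormedAddCommGroup H] [InnerProductSpace ℂ H]
  {K : Type w} [NormedAddCommGroup K] [InnerProductSpace ℂ K]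
  {L : Type*} [NormedAddCommGroup L] [InnerProductSpace ℂ L]

theorem id_total : (Submodule.span ℂ (range fun x : h => x)).topologicalClosure = ⊤ := by
  rw [range_id', Submodule.span_univ]
  exact eq_top_iff.2 (Submodule.le_topologicalClosure _)

variable (h H) in
/-- The vectors `u ⊗ ε(f)`. -/
noncomputable def prodExpVec (p : h × H) : HilbertTensor h (Fock H) := htmul p.1 (expVec p.2)

theorem prodExpVec_total : (Submodule.span ℂ (range (prodExpVec h H))).topologicalClosure = ⊤ :=
  htmul_total (a := fun x : h => x) (b := expVec (H := H)) id_total expVec_total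

/-- The ampliated second quantisation of a unitary `V`, a unitary on `h ⊗ Fock`
with `u ⊗ ε(f) ↦ u ⊗ ε(V f)`. -/
noncomputable def secondQuant (V : H ≃ₗᵢ[ℂ] K) :
    HilbertTensor h (Fock H) ≃ₗᵢ[ℂ] HilbertTensor h (Fock K) :=
  gramEquiv (prodExpVec h H) (fun p => prodExpVec h K (p.1, V p.2)) prodExpVec_total
    (by
      have hr : range (fun p : h × H => prodExpVec h K (p.1, V p.2)) = range (prodExpVec h K) :=
        ((Equiv.refl h).prodCongr V.toEquiv).surjective.range_comp (prodExpVec h K)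
      rw [hr]
      exact prodExpVec_total)
    (by
      intro i j
      simp only [prodExpVec, inner_htmul, inner_expVec, LinearIsometryEquiv.inner_map_map])

theorem secondQuant_apply (V : H ≃ₗᵢ[ℂ] K) (u : h) (f : H) :
    secondQuant V (htmul u (expVec f)) = htmul u (expVec (V f)) :=
  gramEquiv_apply (prodExpVec h H) _ _ _ _ (u, f)

/-- The tensor factorisation of Fock space over `H ≅ K ⊕ L`, ampliated to `h`:
`u ⊗ ε(f) ↦ (u ⊗ ε(f_K)) ⊗ ε(f_L)`. -/
noncomputable def fockSplit (θ : H ≃ₗᵢ[ℂ] WithLp 2 (K × L)) :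
    HilbertTensor h (Fock H) ≃ₗᵢ[ℂ] HilbertTensor (HilbertTensor h (Fock K)) (Fock L) :=
  gramEquiv (prodExpVec h H)
    (fun p => htmul (htmul p.1 (expVec (θ p.2).fst)) (expVec (θ p.2).snd)) prodExpVec_total
    (by
      let φ : h × H → (h × K) × L := fun p => ((p.1, (θ p.2).fst), (θ p.2).snd)
      have hφ : Function.Surjective φ := by
        rintro ⟨⟨u, x⟩, y⟩
        exact ⟨(u, θ.symm (WithLp.toLp 2 (x, y))), by simp [φ]⟩
      have hr := hφ.range_comp (fun q : (h × K) × L => htmul (prodExpVec h K q.1) (expVec q.2))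
      exact (congrArg (fun s => (Submodule.span ℂ s).topologicalClosure) hr).trans
        (htmul_total (a := prodExpVec h K) (b := expVec (H := L)) prodExpVec_total expVec_total))
    (by
      intro i j
      simp only [prodExpVec, inner_htmul, inner_expVec]
      have hθ := (WithLp.prod_inner_apply (𝕜 := ℂ) (θ i.2) (θ j.2)).symm
      rw [LinearIsometryEquiv.inner_map_map] at hθ
      rw [mul_assoc, ← Complex.exp_add, ← hθ]
      rfl)

theorem fockSplit_apply (θ : H ≃ₗᵢ[ℂ] WithLp 2 (K × L)) (u : h) (f : H) :
    fockSplit θ (htmul u (expVec f)) =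
      htmul (htmul u (expVec (θ f).fst)) (expVec (θ f).snd) :=
  gramEquiv_apply (prodExpVec h H) _ _ _ _ (u, f)

end Exponential

section L2

variable (k : Type v) [NormedAddCommGroup k]

/-- The Hilbert space `L²(I; k)` for Lebesgue measure. The half-line is `I = Ici 0`. -/
abbrev L2 (I : Set ℝ) : Type v := Lp k 2 (volume.restrict I)

variable {k} {I J U : Set ℝ}

theorem memLp_restrict (hIU : I ⊆ U) (f : L2 k U) : MemLp f 2 (volume.restrict I) :=
  (Lp.memLp f).mono_measure (Measure.restrict_mono hIU le_rfl)

variable [InnerProductSpace ℂ k]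

/-- The restriction `f ↦ f|_I`. -/
noncomputable def restrictL2 (hIU : I ⊆ U) : L2 k U →ₗ[ℂ] L2 k I where
  toFun f := (memLp_restrict hIU f).toLp f
  map_add' f g := (MemLp.toLp_congr (memLp_restrict hIU (f + g))
      ((memLp_restrict hIU f).add (memLp_restrict hIU g))
      (ae_mono (Measure.restrict_mono hIU le_rfl) (Lp.coeFn_add f g))).trans
    (MemLp.toLp_add _ _)
  map_smul' c f := (MemLp.toLp_congr (memLp_restrict hIU (c • f))
      ((memLp_restrict hIU f).const_smul c)
      (ae_mono (Measure.restrict_mono hIU le_rfl) (Lp.coeFn_smul c f))).trans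
    (MemLp.toLp_const_smul _ _)

theorem restrictL2_coe (hIU : I ⊆ U) (f : L2 k U) :
    restrictL2 hIU f =ᵐ[volume.restrict I] f :=
  (memLp_restrict hIU f).coeFn_toLp

theorem inner_restrictL2 (hIU : I ⊆ U) (f g : L2 k U) :
    ⟪restrictL2 hIU f, restrictL2 hIU g⟫_ℂ = ∫ u in I, ⟪f u, g u⟫_ℂ := by
  rw [L2.inner_def]
  refine integral_congr_ae ?_
  filter_upwards [restrictL2_coe hIU f, restrictL2_coe hIU g] with u h1 h2
  rw [h1, h2]

/-- `L²(I ∪ J; k) ≅ L²(I; k) ⊕ L²(J; k)`, `f ↦ (f|_I, f|_J)`, for disjoint `I`, `J`. -/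
noncomputable def splitL2 (hI : MeasurableSet I) (hJ : MeasurableSet J) (hd : Disjoint I J)
    (hU : I ∪ J = U) : L2 k U ≃ₗᵢ[ℂ] WithLp 2 (L2 k I × L2 k J) :=
  LinearIsometryEquiv.ofSurjective
    (LinearMap.isometryOfInner
      ((WithLp.linearEquiv 2 ℂ (L2 k I × L2 k J)).symm.toLinearMap ∘ₗ
        (restrictL2 (hU ▸ subset_union_left)).prod (restrictL2 (hU ▸ subset_union_right)))
      (by
        intro f g
        have hint : Integrable (fun u => ⟪f u, g u⟫_ℂ) (volume.restrict U) :=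
          L2.integrable_inner f g
        refine (WithLp.prod_inner_apply _ _).trans ?_
        refine (congrArg₂ (· + ·) (inner_restrictL2 (hU ▸ subset_union_left) f g)
          (inner_restrictL2 (hU ▸ subset_union_right) f g)).trans ?_
        rw [L2.inner_def]
        subst hU
        exact (setIntegral_union hd hJ (hint.mono_measure (Measure.restrict_mono subset_union_left le_rfl))
          (hint.mono_measure (Measure.restrict_mono subset_union_right le_rfl))).symm))
    (by
      intro p
      have hIU : I ⊆ U := hU ▸ subset_union_left
      have hJU : J ⊆ U := hU ▸ subset_union_right
      have m1 : MemLp (I.indicator p.fst) 2 (volume.restrict U) := by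
        rw [memLp_indicator_iff_restrict hI, Measure.restrict_restrict hI, inter_eq_left.2 hIU]
        exact Lp.memLp p.fst
      have m2 : MemLp (J.indicator p.snd) 2 (volume.restrict U) := by
        rw [memLp_indicator_iff_restrict hJ, Measure.restrict_restrict hJ, inter_eq_left.2 hJU]
        exact Lp.memLp p.snd
      have hc : ((m1.add m2).toLp : L2 k U) =ᵐ[volume.restrict U]
          I.indicator p.fst + J.indicator p.snd := MemLp.coeFn_toLp _
      refine ⟨(m1.add m2).toLp, ?_⟩
      have e1 : restrictL2 hIU ((m1.add m2).toLp : L2 k U) = p.fst := by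
        apply Lp.ext
        filter_upwards [restrictL2_coe hIU ((m1.add m2).toLp : L2 k U),
          ae_mono (Measure.restrict_mono hIU le_rfl) hc, ae_restrict_mem hI] with u h1 h2 h3
        rw [h1, h2, Pi.add_apply, indicator_of_mem h3,
          indicator_of_notMem (disjoint_left.1 hd h3), add_zero]
      have e2 : restrictL2 hJU ((m1.add m2).toLp : L2 k U) = p.snd := by
        apply Lp.ext
        filter_upwards [restrictL2_coe hJU ((m1.add m2).toLp : L2 k U),
          ae_mono (Measure.restrict_mono hJU le_rfl) hc, ae_restrict_mem hJ] with u h1 h2 h3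
        rw [h1, h2, Pi.add_apply, indicator_of_mem h3,
          indicator_of_notMem (disjoint_right.1 hd h3), zero_add]
      exact congrArg (WithLp.toLp 2) (Prod.ext e1 e2))

theorem splitL2_fst (hI : MeasurableSet I) (hJ : MeasurableSet J) (hd : Disjoint I J)
    (hU : I ∪ J = U) (f : L2 k U) :
    (splitL2 hI hJ hd hU f).fst = restrictL2 (hU ▸ subset_union_left) f := rfl

theorem splitL2_snd (hI : MeasurableSet I) (hJ : MeasurableSet J) (hd : Disjoint I J)
    (hU : I ∪ J = U) (f : L2 k U) :
    (splitL2 hI hJ hd hU f).snd = restrictL2 (hU ▸ subset_union_right) f := rfl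

/-- The unitary `f ↦ f ∘ φ` given by a measure preserving bijection `φ`. -/
noncomputable def compL2 (φ ψ : ℝ → ℝ)
    (hφ : MeasurePreserving φ (volume.restrict I) (volume.restrict J))
    (hψ : MeasurePreserving ψ (volume.restrict J) (volume.restrict I))
    (hψφ : ψ ∘ φ = id) : L2 k J ≃ₗᵢ[ℂ] L2 k I :=
  LinearIsometryEquiv.ofSurjective (Lp.compMeasurePreservingₗᵢ ℂ φ hφ) (by
    intro f
    refine ⟨Lp.compMeasurePreserving ψ hψ f, ?_⟩
    change Lp.compMeasurePreserving φ hφ (Lp.compMeasurePreserving ψ hψ f) = f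
    apply Lp.ext
    have h1 := Lp.coeFn_compMeasurePreserving (Lp.compMeasurePreserving ψ hψ f) hφ
    have h2 := hφ.quasiMeasurePreserving.ae_eq_comp (Lp.coeFn_compMeasurePreserving f hψ)
    refine h1.trans (h2.trans ?_)
    rw [Function.comp_assoc, hψφ, Function.comp_id])

theorem compL2_coe (φ ψ : ℝ → ℝ)
    (hφ : MeasurePreserving φ (volume.restrict I) (volume.restrict J))
    (hψ : MeasurePreserving ψ (volume.restrict J) (volume.restrict I))
    (hψφ : ψ ∘ φ = id) (f : L2 k J) :
    compL2 φ ψ hφ hψ hψφ f =ᵐ[volume.restrict I] f ∘ φ :=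
  Lp.coeFn_compMeasurePreserving f hφ

theorem measurePreserving_shift (t : ℝ) :
    MeasurePreserving (fun u : ℝ => u - t) (volume.restrict (Ici t)) (volume.restrict (Ici 0)) := by
  have h := (measurePreserving_sub_right (volume : Measure ℝ) t).restrict_preimage
    (measurableSet_Ici (a := (0 : ℝ)))
  have he : (fun u : ℝ => u - t) ⁻¹' Ici 0 = Ici t := by ext u; simp
  rwa [he] at h

theorem measurePreserving_unshift (t : ℝ) :
    MeasurePreserving (fun u : ℝ => u + t) (volume.restrict (Ici 0)) (volume.restrict (Ici t)) := by
  have h := (measurePreserving_add_right (volume : Measure ℝ) t).restrict_preimage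
    (measurableSet_Ici (a := t))
  have he : (fun u : ℝ => u + t) ⁻¹' Ici t = Ici 0 := by ext u; simp
  rwa [he] at h

variable (k) in
/-- The time shift `(s_t f)(u) = f(u - t)`, `u ≥ t`, as a unitary from `L²(ℝ₊; k)` onto
`L²([t, ∞); k)`. -/
noncomputable def shiftL2 (t : ℝ) : L2 k (Ici 0) ≃ₗᵢ[ℂ] L2 k (Ici t) :=
  compL2 (fun u => u - t) (fun u => u + t) (measurePreserving_shift t)
    (measurePreserving_unshift t) (by funext u; simp)

/-- The map `u ↦ t - u` on `[0, t]`, extended by the identity. -/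
noncomputable def reflect (t u : ℝ) : ℝ := if u ∈ Icc 0 t then t - u else u

theorem reflect_mem {t u : ℝ} : reflect t u ∈ Icc 0 t ↔ u ∈ Icc 0 t := by
  unfold reflect
  split_ifs with h
  · simp only [mem_Icc] at h ⊢
    constructor <;> intro _ <;> constructor <;> linarith
  · rfl

theorem reflect_reflect (t : ℝ) : reflect t ∘ reflect t = id := by
  funext u
  by_cases h : u ∈ Icc 0 t
  · have h' : t - u ∈ Icc 0 t := by
      simp only [mem_Icc] at h ⊢
      constructor <;> linarith
    simp only [Function.comp_apply, reflect, if_pos h, if_pos h', id]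
    ring
  · simp only [Function.comp_apply, reflect, if_neg h, id]

theorem measurePreserving_reflect (t : ℝ) :
    MeasurePreserving (reflect t) (volume.restrict (Ici 0)) (volume.restrict (Ici 0)) := by
  have hm : Measurable (reflect t) :=
    Measurable.ite measurableSet_Icc (measurable_const.sub measurable_id) measurable_id
  have hv : MeasurePreserving (reflect t) volume volume := by
    refine ⟨hm, Measure.ext fun s hs => ?_⟩
    rw [Measure.map_apply hm hs, ← measure_inter_add_sdiff _ (measurableSet_Icc (a := (0 : ℝ)) (b := t)),
      ← measure_inter_add_sdiff s (measurableSet_Icc (a := (0 : ℝ)) (b := t))]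
    congr 1
    · rw [← (Measure.measurePreserving_sub_left volume t).measure_preimage
        (hs.inter measurableSet_Icc).nullMeasurableSet]
      congr 1
      ext u
      simp only [mem_inter_iff, mem_preimage, reflect]
      constructor
      · rintro ⟨h1, h2⟩
        rw [if_pos h2] at h1
        refine ⟨h1, ?_⟩
        simp only [mem_Icc] at h2 ⊢
        constructor <;> linarith
      · rintro ⟨h1, h2⟩
        have h3 : u ∈ Icc 0 t := by
          simp only [mem_Icc] at h2 ⊢
          constructor <;> linarith
        rw [if_pos h3]
        exact ⟨h1, h3⟩
    · congr 1
      ext u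
      simp only [mem_sdiff, mem_preimage, reflect]
      constructor
      · rintro ⟨h1, h2⟩
        rw [if_neg h2] at h1
        exact ⟨h1, h2⟩
      · rintro ⟨h1, h2⟩
        rw [if_neg h2]
        exact ⟨h1, h2⟩
  have h := hv.restrict_preimage (measurableSet_Ici (a := (0 : ℝ)))
  have he : reflect t ⁻¹' Ici 0 = Ici 0 := by
    ext u
    simp only [mem_preimage, mem_Ici, reflect]
    split_ifs with h
    · simp only [mem_Icc] at h
      constructor <;> intro _ <;> linarith
    · rfl
  rwa [he] at h

variable (k) in
/-- The time reversal `(r_t f)(u) = f(t - u)` for `u ≤ t` and `f(u)` for `u > t`. -/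
noncomputable def reflectL2 (t : ℝ) : L2 k (Ici 0) ≃ₗᵢ[ℂ] L2 k (Ici 0) :=
  compL2 (reflect t) (reflect t) (measurePreserving_reflect t) (measurePreserving_reflect t)
    (reflect_reflect t)

variable (k) in
/-- `L²(ℝ₊; k) ≅ L²([0, t); k) ⊕ L²([t, ∞); k)`. -/
noncomputable def pastFuture (t : ℝ≥0) :
    L2 k (Ici 0) ≃ₗᵢ[ℂ] WithLp 2 (L2 k (Ico 0 (t : ℝ)) × L2 k (Ici (t : ℝ))) :=
  splitL2 measurableSet_Ico measurableSet_Ici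
    (disjoint_left.2 fun _ h1 h2 => not_le_of_gt h1.2 h2) (Ico_union_Ici_eq_Ici t.coe_nonneg)

variable (k) in
/-- The same decomposition with the summands in the other order. -/
noncomputable def futurePast (t : ℝ≥0) :
    L2 k (Ici 0) ≃ₗᵢ[ℂ] WithLp 2 (L2 k (Ici (t : ℝ)) × L2 k (Ico 0 (t : ℝ))) :=
  splitL2 measurableSet_Ici measurableSet_Ico
    (disjoint_left.2 fun _ h1 h2 => not_le_of_gt h2.2 h1)
    ((union_comm _ _).trans (Ico_union_Ici_eq_Ici t.coe_nonneg))

/-- The step function `c 1_{[0, t)}`. -/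
noncomputable def stepL2 (c : k) (t : ℝ≥0) : L2 k (Ici 0) :=
  indicatorConstLp 2 (measurableSet_Ico (a := (0 : ℝ)) (b := (t : ℝ)))
    ((Measure.restrict_apply_le _ _).trans_lt measure_Ico_lt_top).ne c

end L2

section Cocycle

variable (h : Type u) [NormedAddCommGroup h] [InnerProductSpace ℂ h]
  (k : Type v) [NormedAddCommGroup k] [InnerProductSpace ℂ k]

/-- The Hilbert space `h ⊗ F_I`, where `F_I` is the symmetric Fock space over `L²(I; k)`. -/
abbrev FockOver (I : Set ℝ) : Type (max u v) := HilbertTensor h (Fock (L2 k I))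

/-- Bounded operators on `h ⊗ F₊`, with `F₊` the symmetric Fock space over `L²(ℝ₊; k)`. -/
abbrev FockOp : Type (max u v) := FockOver h k (Ici 0) →L[ℂ] FockOver h k (Ici 0)

variable {h k}

/-- The operator `U* T U` for a unitary `U`. -/
noncomputable def unitaryPullback {A : Type u} {B : Type v}
    [NormedAddCommGroup A] [InnerProductSpace ℂ A] [NormedAddCommGroup B] [InnerProductSpace ℂ B]
    (V : A ≃ₗᵢ[ℂ] B) (T : B →L[ℂ] B) : A →L[ℂ] A :=
  (V.symm.toContinuousLinearEquiv : B →L[ℂ] A) ∘L T ∘L (V.toContinuousLinearEquiv : A →L[ℂ] B)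

variable (h k) in
/-- The time shift as a unitary from `h ⊗ F₊` onto `h ⊗ F_{[t, ∞)}`. -/
noncomputable def fockShift (t : ℝ≥0) : FockOver h k (Ici 0) ≃ₗᵢ[ℂ] FockOver h k (Ici (t : ℝ)) :=
  secondQuant (shiftL2 k t)

/-- The endomorphism semigroup `σ_t` on `B(h ⊗ F₊)`: transport `T` to an operator on
`h ⊗ F_{[t, ∞)}` by the time shift and ampliate it by the identity of `F_{[0, t)}`. -/
noncomputable def ccrFlow (t : ℝ≥0) (T : FockOp h k) : FockOp h k :=
  unitaryPullback (fockSplit (futurePast k t))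
    (amplify (unitaryPullback (fockShift h k t).symm T))

variable (h k) in
/-- The time reversal operator `R_t` on `h ⊗ F₊`, `R_t (u ⊗ ε(f)) = u ⊗ ε(r_t f)`. -/
noncomputable def timeReversal (t : ℝ≥0) : FockOp h k :=
  ((secondQuant (h := h) (reflectL2 k t)).toContinuousLinearEquiv :
    FockOver h k (Ici 0) →L[ℂ] FockOver h k (Ici 0))

/-- `T ∈ B(h ⊗ F_{[0, t)}) ⊗ I`, with `I` the identity of `F_{[t, ∞)}`. -/
def IsAdapted (t : ℝ≥0) (T : FockOp h k) : Prop :=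
  ∃ Y : FockOver h k (Ico 0 (t : ℝ)) →L[ℂ] FockOver h k (Ico 0 (t : ℝ)),
    T = unitaryPullback (fockSplit (pastFuture k t)) (amplify Y)

/-- Fock-adapted left operator cocycles. -/
structure IsLeftCocycle (X : ℝ≥0 → FockOp h k) : Prop where
  adapted : ∀ t, IsAdapted t (X t)
  zero : X 0 = 1
  add : ∀ r t, X (r + t) = X r * ccrFlow r (X t)

/-- Fock-adapted right operator cocycles. -/
structure IsRightCocycle (X : ℝ≥0 → FockOp h k) : Prop where
  adapted : ∀ t, IsAdapted t (X t)
  zero : X 0 = 1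
  add : ∀ r t, X (r + t) = ccrFlow r (X t) * X r

/-- The time reversed process `t ↦ R_t X_t R_t`. -/
noncomputable def reversed (X : ℝ≥0 → FockOp h k) (t : ℝ≥0) : FockOp h k :=
  timeReversal h k t * X t * timeReversal h k t

variable [CompleteSpace h]

/-- The adjoint process `t ↦ X_t*`. -/
noncomputable def adjointProcess (X : ℝ≥0 → FockOp h k) (t : ℝ≥0) : FockOp h k :=
  ContinuousLinearMap.adjoint (X t)

/-- The operators `Q^{c,d}_t = E^{ε(c 1_{[0, t)})} X_t E_{ε(d 1_{[0, t)})}` on `h`, where `E^x` is the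
adjoint of `E_x`. -/
noncomputable def assocSemigroup (X : ℝ≥0 → FockOp h k) (c d : k) (t : ℝ≥0) : h →L[ℂ] h :=
  ContinuousLinearMap.adjoint (tensorRight (H := h) (expVec (stepL2 c t))) ∘L X t ∘L
    tensorRight (H := h) (expVec (stepL2 d t))

/-- The norm-closed unital algebra generated by all the `Q^{c,d}_t`. -/
noncomputable def cptAlgebra (X : ℝ≥0 → FockOp h k) : Subalgebra ℂ (h →L[ℂ] h) :=
  (Algebra.adjoin ℂ {T | ∃ (c d : k) (t : ℝ≥0), T = assocSemigroup X c d t}).topologicalClosure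

/-- The von Neumann algebra generated by a set `S` of bounded operators: the double commutant of
`S ∪ S*`. -/
noncomputable def vonNeumannGenerated (S : Set (h →L[ℂ] h)) : VonNeumannAlgebra h where
  toStarSubalgebra := StarSubalgebra.centralizer ℂ (StarSubalgebra.centralizer ℂ S : Set (h →L[ℂ] h))
  centralizer_centralizer' := by
    change Set.centralizer (Set.centralizer
      (StarSubalgebra.centralizer ℂ (StarSubalgebra.centralizer ℂ S : Set (h →L[ℂ] h)) :
        Set (h →L[ℂ] h))) =
      (StarSubalgebra.centralizer ℂ (StarSubalgebra.centralizer ℂ S : Set (h →L[ℂ] h)) :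
        Set (h →L[ℂ] h))
    simp

/-- The von Neumann algebra generated by all the `Q^{c,d}_t`. -/
noncomputable def cptVonNeumann (X : ℝ≥0 → FockOp h k) : VonNeumannAlgebra h :=
  vonNeumannGenerated (cptAlgebra X : Set (h →L[ℂ] h))

end Cocycle

end FockCocycle

open FockCocycle

/-!
The coefficients `E^{ε(f)} T E_{ε(g)}`, operators on the initial space `h`, determine a bounded
operator `T` on `h ⊗ F₊`, because exponential vectors are total. In these terms an operator `T`
adapted at time `r` and a shifted operator `σ_r(S)` multiply as
`coeff (T σ_r(S)) f g = coeff T (f on [0, r)) (g on [0, r)) * coeff S (s_r* f) (s_r* g)`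
(`matrixCoeff_mul_ccrFlow`), and `σ_r(S) T` gives the same two factors in the other order. For a
left cocycle, the coefficients between step functions are therefore the products
`Q^{c₁,d₁}_{t₁} Q^{c₂,d₂}_{t₂} ⋯` taken in the order of time, and for a right cocycle they are the
products in the reverse order.

Coefficients depend continuously on `f` and `g`, and pairs of step functions on a common grid are
dense (`past_induction`). So a left cocycle, and likewise a right cocycle, is determined by its
semigroups `Q^{c,d}`, and all coefficients of `X_t` lie in the algebra `A_X` (`cptAlgebra X`) which
the semigroups generate.

The adjoint process and the time reversal of a left cocycle `X` are both right cocycles, with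
semigroups `(Q^{d,c})*` and `Q^{c,d}` respectively. By uniqueness, `X` is a right cocycle iff it
equals its time reversal, and `X* = X~` iff `(Q^{c,d})* = Q^{d,c}`. Comparing the coefficient of
`X_{r+t}` between two-step functions in the left and right cocycle identities shows that the
generators of `A_X` commute when `X` is both a left and a right cocycle; conversely, if `A_X` is
commutative the two factors of `coeff (X_r σ_r(X_t))` commute. Part (c) combines these facts: a
self-adjoint left cocycle equals its adjoint process and so is a right cocycle.
-/

namespace FockCocycle

/-! ### Operator coefficients between exponential vectors -/

section Coefficients

variable {h : Type u} [NormedAddCommGroup h] [InnerProductSpace ℂ h]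
  {H : Type v} [NormedAddCommGroup H] [InnerProductSpace ℂ H]

theorem continuous_expVec : Continuous (expVec : H → Fock H) := by
  rw [continuous_iff_continuousAt]
  intro f
  rw [ContinuousAt, tendsto_iff_norm_sub_tendsto_zero]
  have hsq : Filter.Tendsto (fun g : H => ‖expVec g - expVec f‖ ^ 2) (nhds f) (nhds 0) := by
    have he : ∀ g : H, ‖expVec g - expVec f‖ ^ 2 = (Complex.exp ⟪g, g⟫_ℂ -
        Complex.exp ⟪f, g⟫_ℂ - (Complex.exp ⟪g, f⟫_ℂ - Complex.exp ⟪f, f⟫_ℂ)).re := by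
      intro g
      rw [← inner_expVec, ← inner_expVec, ← inner_expVec, ← inner_expVec, ← inner_sub_left,
        ← inner_sub_left, ← inner_sub_right]
      exact (inner_self_eq_norm_sq (𝕜 := ℂ) _).symm
    simp_rw [he]
    have hc : Continuous fun g : H => (Complex.exp ⟪g, g⟫_ℂ -
        Complex.exp ⟪f, g⟫_ℂ - (Complex.exp ⟪g, f⟫_ℂ - Complex.exp ⟪f, f⟫_ℂ)).re := by
      fun_prop
    simpa using hc.tendsto f
  simpa using hsq.sqrt

theorem continuous_tensorRight {A : Type u} [NormedAddCommGroup A] [InnerProductSpace ℂ A]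
    {B : Type v} [NormedAddCommGroup B] [InnerProductSpace ℂ B] :
    Continuous (tensorRight : B → A →L[ℂ] HilbertTensor A B) := by
  unfold tensorRight
  exact continuous_const.clm_comp (ContinuousLinearMap.continuous _)

theorem ext_prodExpVec {G : Type*} [NormedAddCommGroup G] [InnerProductSpace ℂ G]
    {S T : HilbertTensor h (Fock H) →L[ℂ] G}
    (hST : ∀ v g, S (htmul v (expVec g)) = T (htmul v (expVec g))) : S = T := by
  refine ContinuousLinearMap.ext_on
    (Submodule.dense_iff_topologicalClosure_eq_top.2 (prodExpVec_total (h := h) (H := H))) ?_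
  rintro _ ⟨p, rfl⟩
  exact hST p.1 p.2

theorem eq_of_inner_prodExpVec {x y : HilbertTensor h (Fock H)}
    (hxy : ∀ u f, ⟪htmul u (expVec f), x⟫_ℂ = ⟪htmul u (expVec f), y⟫_ℂ) : x = y := by
  have : innerSL ℂ x = innerSL ℂ y := by
    refine ext_prodExpVec fun u f => ?_
    have := congrArg (starRingEnd ℂ) (hxy u f)
    simpa only [inner_conj_symm, innerSL_apply_apply] using this
  exact ext_inner_right ℂ fun v => congrArg (fun φ => φ v) this

variable [CompleteSpace h]

/-- The operator `E^{ε(f)} T E_{ε(g)}` on the initial space `h`. -/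
noncomputable def matrixCoeff (T : HilbertTensor h (Fock H) →L[ℂ] HilbertTensor h (Fock H))
    (f g : H) : h →L[ℂ] h :=
  ContinuousLinearMap.adjoint (tensorRight (H := h) (expVec f)) ∘L T ∘L tensorRight (expVec g)

theorem inner_matrixCoeff (T : HilbertTensor h (Fock H) →L[ℂ] HilbertTensor h (Fock H))
    (f g : H) (u v : h) :
    ⟪u, matrixCoeff T f g v⟫_ℂ = ⟪htmul u (expVec f), T (htmul v (expVec g))⟫_ℂ := by
  simp [matrixCoeff, ContinuousLinearMap.adjoint_inner_right]

theorem matrixCoeff_ext {S T : HilbertTensor h (Fock H) →L[ℂ] HilbertTensor h (Fock H)}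
    (hST : ∀ f g, matrixCoeff S f g = matrixCoeff T f g) : S = T :=
  ext_prodExpVec fun v g => eq_of_inner_prodExpVec fun u f => by
    rw [← inner_matrixCoeff, ← inner_matrixCoeff, hST]

theorem matrixCoeff_adjoint (T : HilbertTensor h (Fock H) →L[ℂ] HilbertTensor h (Fock H))
    (f g : H) : matrixCoeff (ContinuousLinearMap.adjoint T) f g =
      ContinuousLinearMap.adjoint (matrixCoeff T g f) := by
  simp [matrixCoeff, ContinuousLinearMap.adjoint_comp, ContinuousLinearMap.comp_assoc]

theorem continuous_matrixCoeff (T : HilbertTensor h (Fock H) →L[ℂ] HilbertTensor h (Fock H)) :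
    Continuous fun p : H × H => matrixCoeff T p.1 p.2 := by
  have h1 : Continuous fun f : H => tensorRight (H := h) (expVec f) :=
    continuous_tensorRight.comp continuous_expVec
  unfold matrixCoeff
  exact ((ContinuousLinearMap.adjoint.continuous.comp h1).comp continuous_fst).clm_comp
    (continuous_const.clm_comp (h1.comp continuous_snd))

end Coefficients

/-! ### Splitting, concatenation and reflection on the half-line -/

section HalfLine

variable {k : Type v} [NormedAddCommGroup k] [InnerProductSpace ℂ k]

/-- The function `s_r* f`, that is `u ↦ f (u + r)`, the adjoint of the time shift applied to `f`. -/
noncomputable def future (r : ℝ≥0) (f : L2 k (Ici 0)) : L2 k (Ici 0) :=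
  (shiftL2 k r).symm (pastFuture k r f).snd

/-- The function `concat r f g` equal to `f` on `[0, r)` and to the shift of `g` by `r` on `[r, ∞)`. -/
noncomputable def concat (r : ℝ≥0) (f g : L2 k (Ici 0)) : L2 k (Ici 0) :=
  (pastFuture k r).symm (WithLp.toLp 2 ((pastFuture k r f).fst, shiftL2 k r g))

/-- The restriction of `f` to `[0, r)`, extended by zero. -/
noncomputable def past (r : ℝ≥0) (f : L2 k (Ici 0)) : L2 k (Ici 0) := concat r f 0

theorem pastFuture_concat (r : ℝ≥0) (f g : L2 k (Ici 0)) :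
    pastFuture k r (concat r f g) = WithLp.toLp 2 ((pastFuture k r f).fst, shiftL2 k r g) := by
  simp [concat]

@[simp] theorem future_concat (r : ℝ≥0) (f g : L2 k (Ici 0)) : future r (concat r f g) = g := by
  rw [future, pastFuture_concat]; simp

@[simp] theorem past_concat (r : ℝ≥0) (f g : L2 k (Ici 0)) : past r (concat r f g) = past r f := by
  rw [past, concat, pastFuture_concat]; rfl

@[simp] theorem past_past (r : ℝ≥0) (f : L2 k (Ici 0)) : past r (past r f) = past r f :=
  past_concat r f 0

@[simp] theorem future_past (r : ℝ≥0) (f : L2 k (Ici 0)) : future r (past r f) = 0 :=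
  future_concat r f 0

theorem inner_fst_pastFuture (r : ℝ≥0) (f g : L2 k (Ici 0)) :
    ⟪(pastFuture k r f).fst, (pastFuture k r g).fst⟫_ℂ = ⟪past r f, past r g⟫_ℂ := by
  rw [← (pastFuture k r).inner_map_map (past r f), past, past, pastFuture_concat,
    pastFuture_concat, WithLp.prod_inner_apply]
  simp

theorem inner_snd_pastFuture (r : ℝ≥0) (f g : L2 k (Ici 0)) :
    ⟪(pastFuture k r f).snd, (pastFuture k r g).snd⟫_ℂ = ⟪future r f, future r g⟫_ℂ := by
  rw [future, future, LinearIsometryEquiv.inner_map_map]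

theorem future_ae (r : ℝ≥0) (f : L2 k (Ici 0)) :
    future r f =ᵐ[volume.restrict (Ici 0)] fun u => f (u + r) := by
  have h1 : shiftL2 k r (future r f) = (pastFuture k r f).snd := by simp [future]
  have h2 : shiftL2 k r (future r f) =ᵐ[volume.restrict (Ici (r : ℝ))]
      fun u => future r f (u - r) := compL2_coe _ _ _ _ _ _
  have h3 : (pastFuture k r f).snd =ᵐ[volume.restrict (Ici (r : ℝ))] f :=
    restrictL2_coe (Ici_subset_Ici.2 r.coe_nonneg) f
  rw [h1] at h2
  have h4 := (measurePreserving_unshift (r : ℝ)).quasiMeasurePreserving.ae (h2.symm.trans h3)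
  filter_upwards [h4] with u hu
  simpa using hu

theorem concat_ae (r : ℝ≥0) (f g : L2 k (Ici 0)) :
    concat r f g =ᵐ[volume.restrict (Ici 0)] fun u => if u < r then f u else g (u - r) := by
  have h1 : (pastFuture k r (concat r f g)).fst = (pastFuture k r f).fst := by
    rw [pastFuture_concat]; rfl
  have h2 : (pastFuture k r (concat r f g)).snd = shiftL2 k r g := by
    rw [pastFuture_concat]; rfl
  have hs : Ico 0 (r : ℝ) ⊆ Ici 0 := fun u hu => hu.1
  have a1 : concat r f g =ᵐ[volume.restrict (Ico 0 (r : ℝ))] f :=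
    ((restrictL2_coe hs (concat r f g)).symm.trans
      (Filter.Eventually.of_forall fun u => congrArg (fun F : L2 k (Ico 0 (r : ℝ)) => F u) h1)).trans
      (restrictL2_coe hs f)
  have a2 : concat r f g =ᵐ[volume.restrict (Ici (r : ℝ))] fun u => g (u - r) :=
    ((restrictL2_coe (Ici_subset_Ici.2 r.coe_nonneg) (concat r f g)).symm.trans
      (Filter.Eventually.of_forall fun u => congrArg (fun F : L2 k (Ici (r : ℝ)) => F u) h2)).trans
      (compL2_coe _ _ _ _ _ _)
  have key : ∀ᵐ u ∂volume.restrict (Ico 0 (r : ℝ) ∪ Ici (r : ℝ)),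
      concat r f g u = if u < r then f u else g (u - r) := by
    rw [ae_restrict_union_iff]
    constructor
    · filter_upwards [a1, ae_restrict_mem measurableSet_Ico] with u hu hm
      rw [hu, if_pos hm.2]
    · filter_upwards [a2, ae_restrict_mem measurableSet_Ici] with u hu hm
      rw [hu, if_neg (not_lt.2 hm)]
  rwa [Ico_union_Ici_eq_Ici r.coe_nonneg] at key

theorem past_ae (r : ℝ≥0) (f : L2 k (Ici 0)) :
    past r f =ᵐ[volume.restrict (Ici 0)] fun u => if u < r then f u else 0 := by
  have h0 : (fun u => (0 : L2 k (Ici 0)) (u - r)) =ᵐ[volume.restrict (Ici (r : ℝ))] 0 :=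
    (measurePreserving_shift (r : ℝ)).quasiMeasurePreserving.ae (Lp.coeFn_zero _ _ _)
  have h1 := (ae_restrict_iff' measurableSet_Ici).1 h0
  filter_upwards [concat_ae r f 0, ae_restrict_of_ae h1] with u hu hz
  rw [past, hu]
  split_ifs with hlt
  · rfl
  · exact hz (not_lt.1 hlt)

omit [InnerProductSpace ℂ k] in
theorem stepL2_ae (c : k) (t : ℝ≥0) :
    stepL2 c t =ᵐ[volume.restrict (Ici 0)] fun u => if u < t then c else 0 := by
  filter_upwards [indicatorConstLp_coeFn (p := 2) (μ := volume.restrict (Ici 0))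
    (hs := measurableSet_Ico (a := (0 : ℝ)) (b := (t : ℝ)))
    (hμs := ((Measure.restrict_apply_le _ _).trans_lt measure_Ico_lt_top).ne) (c := c),
    ae_restrict_mem measurableSet_Ici] with u hu hm
  rw [stepL2, hu, indicator_apply]
  exact if_congr ⟨fun hh => hh.2, fun hh => ⟨hm, hh⟩⟩ rfl rfl

theorem past_stepL2 (c : k) (t : ℝ≥0) : past t (stepL2 c t) = stepL2 c t := by
  apply Lp.ext
  filter_upwards [past_ae t (stepL2 c t), stepL2_ae c t] with u h1 h2
  rw [h1, h2]
  split_ifs <;> rfl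

theorem reflectL2_ae (t : ℝ) (f : L2 k (Ici 0)) :
    reflectL2 k t f =ᵐ[volume.restrict (Ici 0)] fun u => f (reflect t u) :=
  compL2_coe _ _ _ _ _ _

theorem quasiMeasurePreserving_add (r : ℝ≥0) :
    Measure.QuasiMeasurePreserving (fun u : ℝ => u + r) (volume.restrict (Ici 0))
      (volume.restrict (Ici 0)) :=
  (measurePreserving_unshift (r : ℝ)).quasiMeasurePreserving.mono_right
    (Measure.restrict_mono (Ici_subset_Ici.2 r.coe_nonneg) le_rfl).absolutelyContinuous

theorem continuous_past (r : ℝ≥0) : Continuous (past r : L2 k (Ici 0) → L2 k (Ici 0)) := by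
  unfold past concat
  fun_prop

theorem reflectL2_reflectL2 (t : ℝ) (f : L2 k (Ici 0)) :
    reflectL2 k t (reflectL2 k t f) = f := by
  apply Lp.ext
  filter_upwards [reflectL2_ae t (reflectL2 k t f),
    (measurePreserving_reflect t).quasiMeasurePreserving.ae (reflectL2_ae t f)] with u h1 h2
  rw [h1, h2]
  exact congrArg f (congrFun (reflect_reflect t) u)

theorem ae_ne_two (a b : ℝ) : ∀ᵐ u : ℝ ∂volume.restrict (Ici 0), 0 < u ∧ u ≠ a ∧ u ≠ b := by
  filter_upwards [ae_restrict_of_ae (Measure.ae_ne volume (0 : ℝ)),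
    ae_restrict_of_ae (Measure.ae_ne volume a), ae_restrict_of_ae (Measure.ae_ne volume b),
    ae_restrict_mem measurableSet_Ici] with u h1 h2 h3 h4
  exact ⟨lt_of_le_of_ne h4 h1.symm, h2, h3⟩

theorem reflect_of_lt {t u : ℝ} (h0 : 0 < u) (h1 : u < t) : reflect t u = t - u :=
  if_pos ⟨h0.le, h1.le⟩

theorem reflect_of_gt {t u : ℝ} (h1 : t < u) : reflect t u = u :=
  if_neg fun hu => not_le_of_gt h1 hu.2

theorem ae_reflect {p : ℝ → Prop} (t : ℝ) (hp : ∀ᵐ u ∂volume.restrict (Ici 0), p u) :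
    ∀ᵐ u ∂volume.restrict (Ici 0), p (reflect t u) :=
  (measurePreserving_reflect t).quasiMeasurePreserving.ae hp

theorem ae_add {p : ℝ → Prop} (t : ℝ≥0) (hp : ∀ᵐ u ∂volume.restrict (Ici 0), p u) :
    ∀ᵐ u ∂volume.restrict (Ici 0), p (u + t) :=
  (quasiMeasurePreserving_add t).ae hp

/-! Reflections are compared almost everywhere: `reflect t` acts on the closed interval `[0, t]`,
whereas `past` and `stepL2` refer to `[0, t)`, so the endpoints are discarded. -/

theorem future_reflectL2 (t : ℝ≥0) (f : L2 k (Ici 0)) :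
    future t (reflectL2 k t f) = future t f := by
  apply Lp.ext
  filter_upwards [future_ae t (reflectL2 k t f), future_ae t f, ae_add t (reflectL2_ae t f),
    ae_ne_two 0 0] with u h1 h2 h3 h4
  rw [h1, h2, h3, reflect_of_gt (by linarith)]

theorem past_reflectL2 (t : ℝ≥0) (f : L2 k (Ici 0)) :
    past t (reflectL2 k t f) = reflectL2 k t (past t f) := by
  apply Lp.ext
  filter_upwards [past_ae t (reflectL2 k t f), reflectL2_ae t (past t f), reflectL2_ae t f,
    ae_reflect t (past_ae t f), ae_ne_two t 0] with u h1 h2 h3 h4 h5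
  rw [h1, h2, h3, h4]
  rcases lt_or_gt_of_ne h5.2.1 with hu | hu
  · rw [reflect_of_lt h5.1 hu, if_pos hu, if_pos (by linarith)]
  · rw [reflect_of_gt hu]

theorem reflectL2_stepL2 (c : k) (t : ℝ≥0) : reflectL2 k t (stepL2 c t) = stepL2 c t := by
  apply Lp.ext
  filter_upwards [reflectL2_ae t (stepL2 c t), stepL2_ae c t, ae_reflect t (stepL2_ae c t),
    ae_ne_two t 0] with u h1 h2 h3 h5
  rw [h1, h2, h3]
  rcases lt_or_gt_of_ne h5.2.1 with hu | hu
  · rw [reflect_of_lt h5.1 hu, if_pos hu, if_pos (by linarith)]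
  · rw [reflect_of_gt hu]

theorem future_future (r t : ℝ≥0) (f : L2 k (Ici 0)) :
    future r (future t f) = future (t + r) f := by
  apply Lp.ext
  filter_upwards [future_ae r (future t f), future_ae (t + r) f, ae_add r (future_ae t f)]
    with u h1 h2 h3
  rw [h1, h2, h3]
  congr 1
  push_cast
  ring

theorem past_reflectL2_add (r t : ℝ≥0) (f : L2 k (Ici 0)) :
    past t (reflectL2 k (t + r : ℝ≥0) f) = past t (reflectL2 k t (future r f)) := by
  apply Lp.ext
  filter_upwards [past_ae t (reflectL2 k (t + r : ℝ≥0) f),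
    past_ae t (reflectL2 k t (future r f)), reflectL2_ae (t + r : ℝ≥0) f,
    reflectL2_ae t (future r f), ae_reflect t (future_ae r f), ae_ne_two t 0]
    with u h1 h2 h3 h4 h5 h6
  rw [h1, h2, h3, h4, h5]
  split_ifs with hu
  · have hr := r.coe_nonneg
    rw [reflect_of_lt h6.1 hu, reflect_of_lt h6.1 (by push_cast; linarith)]
    congr 1
    push_cast
    ring
  · rfl

theorem past_future_reflectL2_add (r t : ℝ≥0) (f : L2 k (Ici 0)) :
    past r (future t (reflectL2 k (t + r : ℝ≥0) f)) = past r (reflectL2 k r f) := by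
  apply Lp.ext
  filter_upwards [past_ae r (future t (reflectL2 k (t + r : ℝ≥0) f)),
    past_ae r (reflectL2 k r f), future_ae t (reflectL2 k (t + r : ℝ≥0) f),
    ae_add t (reflectL2_ae (t + r : ℝ≥0) f), reflectL2_ae r f, ae_ne_two 0 0]
    with u h1 h2 h3 h4 h5 h6
  rw [h1, h2, h3, h4, h5]
  split_ifs with hu
  · have ht := t.coe_nonneg
    rw [reflect_of_lt h6.1 hu, reflect_of_lt (by linarith) (by push_cast; linarith)]
    congr 1
    push_cast
    ring
  · rfl

end HalfLine

/-! ### Coefficients of the flow, of adapted operators and of time reversals -/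

section Operators

variable {h : Type u} [NormedAddCommGroup h] [InnerProductSpace ℂ h]
  {k : Type v} [NormedAddCommGroup k] [InnerProductSpace ℂ k]

theorem inner_unitaryPullback {A : Type u} {B : Type v}
    [NormedAddCommGroup A] [InnerProductSpace ℂ A] [NormedAddCommGroup B] [InnerProductSpace ℂ B]
    (V : A ≃ₗᵢ[ℂ] B) (T : B →L[ℂ] B) (x y : A) :
    ⟪x, unitaryPullback V T y⟫_ℂ = ⟪V x, T (V y)⟫_ℂ := by
  change ⟪x, V.symm (T (V y))⟫_ℂ = _
  rw [← V.inner_map_map, V.apply_symm_apply]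

theorem fockSplit_pastFuture (r : ℝ≥0) (u : h) (f : L2 k (Ici 0)) :
    fockSplit (pastFuture k r) (htmul u (expVec f)) =
      htmul (htmul u (expVec (pastFuture k r f).fst)) (expVec (pastFuture k r f).snd) :=
  fockSplit_apply _ u f

theorem fockSplit_futurePast (r : ℝ≥0) (u : h) (f : L2 k (Ici 0)) :
    fockSplit (futurePast k r) (htmul u (expVec f)) =
      htmul (htmul u (expVec (pastFuture k r f).snd)) (expVec (pastFuture k r f).fst) :=
  fockSplit_apply _ u f

theorem shiftL2_future (r : ℝ≥0) (f : L2 k (Ici 0)) :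
    shiftL2 k r (future r f) = (pastFuture k r f).snd := by
  simp [future]

theorem fockShift_symm_snd (r : ℝ≥0) (u : h) (f : L2 k (Ici 0)) :
    (fockShift h k r).symm (htmul u (expVec (pastFuture k r f).snd)) =
      htmul u (expVec (future r f)) := by
  rw [LinearIsometryEquiv.symm_apply_eq, fockShift, secondQuant_apply, shiftL2_future]

/-- The operator by which `ccrFlow r S` acts on `h ⊗ F_{[r, ∞)}`, between exponential vectors. -/
theorem inner_shifted (r : ℝ≥0) (S : FockOp h k) (u v : h) (f g : L2 k (Ici 0)) :
    ⟪htmul u (expVec (pastFuture k r f).snd), unitaryPullback (fockShift h k r).symm S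
      (htmul v (expVec (pastFuture k r g).snd))⟫_ℂ =
      ⟪htmul u (expVec (future r f)), S (htmul v (expVec (future r g)))⟫_ℂ := by
  rw [inner_unitaryPullback, fockShift_symm_snd, fockShift_symm_snd]

theorem ccrFlow_apply (r : ℝ≥0) (S : FockOp h k) (v : h) (g : L2 k (Ici 0)) :
    ccrFlow r S (htmul v (expVec g)) = (fockSplit (futurePast k r)).symm
      (htmul (unitaryPullback (fockShift h k r).symm S (htmul v (expVec (pastFuture k r g).snd)))
        (expVec (pastFuture k r g).fst)) := by
  change (fockSplit (futurePast k r)).symm (amplify _ (fockSplit (futurePast k r) _)) = _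
  rw [fockSplit_futurePast, amplify_htmul]

theorem timeReversal_apply (t : ℝ≥0) (u : h) (f : L2 k (Ici 0)) :
    timeReversal h k t (htmul u (expVec f)) = htmul u (expVec (reflectL2 k t f)) :=
  secondQuant_apply _ u f

theorem timeReversal_mul_self (t : ℝ≥0) : timeReversal h k t * timeReversal h k t = 1 :=
  ext_prodExpVec fun u f => by
    rw [mul_apply_eq_comp, timeReversal_apply, timeReversal_apply,
      reflectL2_reflectL2]; rfl

theorem inner_timeReversal (t : ℝ≥0) (x y : FockOver h k (Ici 0)) :
    ⟪x, timeReversal h k t y⟫_ℂ = ⟪timeReversal h k t x, y⟫_ℂ := by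
  have h2 : timeReversal h k t (timeReversal h k t y) = y :=
    congrArg (fun A : FockOp h k => A y) (timeReversal_mul_self t)
  have h1 : ⟪timeReversal h k t x, timeReversal h k t (timeReversal h k t y)⟫_ℂ =
      ⟪x, timeReversal h k t y⟫_ℂ :=
    (secondQuant (h := h) (reflectL2 k t)).inner_map_map _ _
  rw [← h1, h2]

variable [CompleteSpace h]

theorem matrixCoeff_ccrFlow (r : ℝ≥0) (S : FockOp h k) (f g : L2 k (Ici 0)) :
    matrixCoeff (ccrFlow r S) f g = Complex.exp ⟪past r f, past r g⟫_ℂ •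
      matrixCoeff S (future r f) (future r g) := by
  refine ContinuousLinearMap.ext fun v => ext_inner_left ℂ fun u => ?_
  rw [inner_matrixCoeff, smul_apply, inner_smul_right, inner_matrixCoeff,
    ccrFlow, inner_unitaryPullback, fockSplit_futurePast, fockSplit_futurePast, amplify_htmul,
    inner_htmul, inner_shifted, inner_expVec, inner_fst_pastFuture, mul_comm]

theorem adjoint_ccrFlow (r : ℝ≥0) (S : FockOp h k) :
    ContinuousLinearMap.adjoint (ccrFlow r S) = ccrFlow r (ContinuousLinearMap.adjoint S) := by
  refine matrixCoeff_ext fun f g => ?_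
  rw [matrixCoeff_adjoint, matrixCoeff_ccrFlow, matrixCoeff_ccrFlow, matrixCoeff_adjoint, map_smulₛₗ,
    ← Complex.exp_conj, inner_conj_symm]

theorem matrixCoeff_amplify (t : ℝ≥0)
    (Y : FockOver h k (Ico 0 (t : ℝ)) →L[ℂ] FockOver h k (Ico 0 (t : ℝ))) (f g : L2 k (Ici 0)) :
    matrixCoeff (unitaryPullback (fockSplit (pastFuture k t)) (amplify Y)) f g =
      Complex.exp ⟪future t f, future t g⟫_ℂ •
        matrixCoeff Y (pastFuture k t f).fst (pastFuture k t g).fst := by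
  refine ContinuousLinearMap.ext fun v => ext_inner_left ℂ fun u => ?_
  rw [inner_matrixCoeff, smul_apply, inner_smul_right, inner_matrixCoeff,
    inner_unitaryPullback, fockSplit_pastFuture, fockSplit_pastFuture, amplify_htmul,
    inner_htmul, inner_expVec, inner_snd_pastFuture, mul_comm]

theorem pastFuture_past_fst (t : ℝ≥0) (f : L2 k (Ici 0)) :
    (pastFuture k t (past t f)).fst = (pastFuture k t f).fst := by
  rw [past, pastFuture_concat]; rfl

theorem pastFuture_past_snd (t : ℝ≥0) (f : L2 k (Ici 0)) :
    (pastFuture k t (past t f)).snd = 0 := by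
  rw [past, pastFuture_concat, map_zero]; rfl

/-- Adaptedness in terms of matrix coefficients. For the converse implication, the operator on
`h ⊗ F_{[0, t)}` is the compression of `T` to the vacuum of `F_{[t, ∞)}`. -/
theorem isAdapted_iff_matrixCoeff (t : ℝ≥0) (T : FockOp h k) :
    IsAdapted t T ↔ ∀ f g, matrixCoeff T f g =
      Complex.exp ⟪future t f, future t g⟫_ℂ • matrixCoeff T (past t f) (past t g) := by
  constructor
  · rintro ⟨Y, rfl⟩ f g
    rw [matrixCoeff_amplify, matrixCoeff_amplify]
    simp [pastFuture_past_fst]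
  · intro hT
    refine ⟨ContinuousLinearMap.adjoint (tensorRight (expVec 0)) ∘L
      unitaryPullback (fockSplit (pastFuture k t)).symm T ∘L tensorRight (expVec 0),
      matrixCoeff_ext fun f g => ?_⟩
    rw [hT f g, matrixCoeff_amplify]
    congr 1
    refine ContinuousLinearMap.ext fun v => ext_inner_left ℂ fun u => ?_
    have hs : ∀ (u : h) (f : L2 k (Ici 0)), (fockSplit (pastFuture k t)).symm
        (htmul (htmul u (expVec (pastFuture k t f).fst)) (expVec 0)) =
        htmul u (expVec (past t f)) := by
      intro u f
      rw [LinearIsometryEquiv.symm_apply_eq, fockSplit_pastFuture, pastFuture_past_fst,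
        pastFuture_past_snd]
    rw [inner_matrixCoeff, inner_matrixCoeff, ContinuousLinearMap.comp_apply,
      ContinuousLinearMap.adjoint_inner_right, ContinuousLinearMap.comp_apply,
      inner_unitaryPullback, tensorRight_apply, tensorRight_apply, hs, hs]

/-- If `T` acts on the Fock space over `[0, r)`, then `T` and `σ_r(S)` act on different tensor
factors apart from the initial space `h`, where their coefficients multiply. -/
theorem matrixCoeff_mul_ccrFlow {r : ℝ≥0} {T : FockOp h k} (hT : IsAdapted r T) (S : FockOp h k)
    (f g : L2 k (Ici 0)) : matrixCoeff (T * ccrFlow r S) f g =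
      matrixCoeff T (past r f) (past r g) * matrixCoeff S (future r f) (future r g) := by
  rw [isAdapted_iff_matrixCoeff] at hT
  refine ContinuousLinearMap.ext fun v => ext_inner_left ℂ fun u => ?_
  set M := matrixCoeff T (past r f) (past r g) with hM
  -- `J z` inserts `ε(g)` restricted to `[0, r)` in front of the vector `z` of `h ⊗ F_{[r, ∞)}`.
  let J : FockOver h k (Ici (r : ℝ)) →L[ℂ] FockOver h k (Ici 0) :=
    ((fockSplit (h := h) (futurePast k r)).symm.toContinuousLinearEquiv :
      HilbertTensor (FockOver h k (Ici (r : ℝ))) (Fock (L2 k (Ico 0 (r : ℝ)))) →L[ℂ]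
        FockOver h k (Ici 0)) ∘L tensorRight (expVec (pastFuture k r g).fst)
  -- Vectors `w ⊗ ε(c)` are total in `h ⊗ F_{[r, ∞)}`, where the image of `v ⊗ ε(g)` under the
  -- shifted `S` is an arbitrary vector, so the functionals are compared on the former.
  have hJ : innerSL ℂ (htmul u (expVec f)) ∘L T ∘L J =
      innerSL ℂ (htmul (ContinuousLinearMap.adjoint M u) (expVec (pastFuture k r f).snd)) := by
    refine ext_prodExpVec fun w c => ?_
    have hc : J (htmul w (expVec c)) =
        htmul w (expVec (concat r g ((shiftL2 k r).symm c))) := by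
      change (fockSplit (futurePast k r)).symm (htmul (htmul w (expVec c)) _) = _
      rw [LinearIsometryEquiv.symm_apply_eq, fockSplit_futurePast, pastFuture_concat]
      simp
    change ⟪htmul u (expVec f), T (J (htmul w (expVec c)))⟫_ℂ = ⟪_, htmul w (expVec c)⟫_ℂ
    rw [hc, ← inner_matrixCoeff, hT, future_concat, past_concat, ← hM, inner_htmul, inner_expVec,
      ContinuousLinearMap.adjoint_inner_left, smul_apply, inner_smul_right,
      mul_comm, future, LinearIsometryEquiv.inner_map_map]
  rw [inner_matrixCoeff, mul_apply_eq_comp, ccrFlow_apply]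
  have := congrArg (fun φ => φ (unitaryPullback (fockShift h k r).symm S
    (htmul v (expVec (pastFuture k r g).snd)))) hJ
  refine Eq.trans this ?_
  rw [innerSL_apply_apply, inner_shifted, ← inner_matrixCoeff,
    ContinuousLinearMap.adjoint_inner_left, mul_apply_eq_comp]

theorem IsAdapted.adjoint {t : ℝ≥0} {T : FockOp h k} (hT : IsAdapted t T) :
    IsAdapted t (ContinuousLinearMap.adjoint T) := by
  rw [isAdapted_iff_matrixCoeff] at hT ⊢
  intro f g
  rw [matrixCoeff_adjoint, matrixCoeff_adjoint, hT, map_smulₛₗ, ← Complex.exp_conj,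
    inner_conj_symm]

/-- The mirror image of `matrixCoeff_mul_ccrFlow`, obtained by taking adjoints. -/
theorem matrixCoeff_ccrFlow_mul {r : ℝ≥0} {T : FockOp h k} (hT : IsAdapted r T) (S : FockOp h k)
    (f g : L2 k (Ici 0)) : matrixCoeff (ccrFlow r S * T) f g =
      matrixCoeff S (future r f) (future r g) * matrixCoeff T (past r f) (past r g) := by
  have key := congrArg ContinuousLinearMap.adjoint
    (matrixCoeff_mul_ccrFlow hT.adjoint (ContinuousLinearMap.adjoint S) g f)
  have h1 : ContinuousLinearMap.adjoint T * ccrFlow r (ContinuousLinearMap.adjoint S) =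
      ContinuousLinearMap.adjoint (ccrFlow r S * T) := by
    rw [← adjoint_ccrFlow]
    exact (star_mul _ _).symm
  rw [h1, matrixCoeff_adjoint, ContinuousLinearMap.adjoint_adjoint] at key
  refine key.trans ((star_mul _ _).trans (congrArg₂ (· * ·) ?_ ?_))
  · rw [matrixCoeff_adjoint]; exact star_star _
  · rw [matrixCoeff_adjoint]; exact star_star _

theorem matrixCoeff_reversed (X : ℝ≥0 → FockOp h k) (t : ℝ≥0) (f g : L2 k (Ici 0)) :
    matrixCoeff (reversed X t) f g = matrixCoeff (X t) (reflectL2 k t f) (reflectL2 k t g) := by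
  refine ContinuousLinearMap.ext fun v => ext_inner_left ℂ fun u => ?_
  rw [inner_matrixCoeff, inner_matrixCoeff, reversed, mul_apply_eq_comp,
    mul_apply_eq_comp, inner_timeReversal, timeReversal_apply, timeReversal_apply]

theorem assocSemigroup_eq (X : ℝ≥0 → FockOp h k) (c d : k) (t : ℝ≥0) :
    assocSemigroup X c d t = matrixCoeff (X t) (stepL2 c t) (stepL2 d t) := rfl

theorem assocSemigroup_reversed (X : ℝ≥0 → FockOp h k) (c d : k) (t : ℝ≥0) :
    assocSemigroup (reversed X) c d t = assocSemigroup X c d t := by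
  rw [assocSemigroup_eq, assocSemigroup_eq, matrixCoeff_reversed, reflectL2_stepL2,
    reflectL2_stepL2]

theorem assocSemigroup_adjointProcess (X : ℝ≥0 → FockOp h k) (c d : k) (t : ℝ≥0) :
    assocSemigroup (adjointProcess X) c d t =
      ContinuousLinearMap.adjoint (assocSemigroup X d c t) :=
  matrixCoeff_adjoint _ _ _

theorem IsLeftCocycle.isRightCocycle_adjointProcess {X : ℝ≥0 → FockOp h k} (hX : IsLeftCocycle X) :
    IsRightCocycle (adjointProcess X) where
  adapted t := (hX.adapted t).adjoint
  zero := by rw [adjointProcess, hX.zero]; exact star_one _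
  add r t := by
    change ContinuousLinearMap.adjoint (X (r + t)) =
      ccrFlow r (ContinuousLinearMap.adjoint (X t)) * ContinuousLinearMap.adjoint (X r)
    rw [hX.add, ← adjoint_ccrFlow]
    exact star_mul _ _

theorem IsRightCocycle.isLeftCocycle_adjointProcess {X : ℝ≥0 → FockOp h k} (hX : IsRightCocycle X) :
    IsLeftCocycle (adjointProcess X) where
  adapted t := (hX.adapted t).adjoint
  zero := by rw [adjointProcess, hX.zero]; exact star_one _
  add r t := by
    change ContinuousLinearMap.adjoint (X (r + t)) =
      ContinuousLinearMap.adjoint (X r) * ccrFlow r (ContinuousLinearMap.adjoint (X t))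
    rw [hX.add, ← adjoint_ccrFlow]
    exact star_mul _ _

theorem isAdapted_reversed {X : ℝ≥0 → FockOp h k} {t : ℝ≥0} (hX : IsAdapted t (X t)) :
    IsAdapted t (reversed X t) := by
  rw [isAdapted_iff_matrixCoeff] at hX ⊢
  intro f g
  rw [matrixCoeff_reversed, matrixCoeff_reversed, hX, future_reflectL2, future_reflectL2,
    past_reflectL2, past_reflectL2]

/-- Time reversal turns left cocycles into right cocycles. -/
theorem IsLeftCocycle.isRightCocycle_reversed {X : ℝ≥0 → FockOp h k} (hX : IsLeftCocycle X) :
    IsRightCocycle (reversed X) where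
  adapted t := isAdapted_reversed (hX.adapted t)
  zero := by rw [reversed, hX.zero, mul_one, timeReversal_mul_self]
  add r t := by
    refine matrixCoeff_ext fun f g => ?_
    have h1 := (isAdapted_iff_matrixCoeff _ _).1 (hX.adapted t)
    have h2 := (isAdapted_iff_matrixCoeff _ _).1 (hX.adapted r)
    -- Reflecting `[0, r + t)` puts the reflection of `[r, r + t)` first, then that of `[0, r)`.
    -- Coefficients are reduced to functions supported on these intervals by adaptedness; both
    -- sides then acquire the same factor from `[r + t, ∞)`.
    rw [matrixCoeff_ccrFlow_mul (isAdapted_reversed (hX.adapted r)), matrixCoeff_reversed,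
      matrixCoeff_reversed, matrixCoeff_reversed, add_comm r t, hX.add,
      matrixCoeff_mul_ccrFlow (hX.adapted t), h1 (reflectL2 k t (future r f)),
      h2 (future t _), past_reflectL2_add, past_reflectL2_add, past_future_reflectL2_add,
      past_future_reflectL2_add, past_reflectL2, past_reflectL2, past_reflectL2, past_reflectL2, future_reflectL2,
      future_reflectL2, future_future, future_future, future_future, future_future,
      future_reflectL2, future_reflectL2, add_comm r t, smul_mul_assoc, mul_smul_comm]

end Operators

/-! ### Density of pairs of step functions -/

section StepFunctions

variable {k : Type v} [NormedAddCommGroup k] [InnerProductSpace ℂ k]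

theorem ae_sub {p : ℝ → Prop} (r : ℝ≥0) (hp : ∀ᵐ u ∂volume.restrict (Ici 0), p u) :
    ∀ᵐ u : ℝ ∂volume.restrict (Ici 0), (r : ℝ) ≤ u → p (u - r) :=
  ae_restrict_of_ae ((ae_restrict_iff' measurableSet_Ici).1
    ((measurePreserving_shift (r : ℝ)).quasiMeasurePreserving.ae hp))

/-- `F` vanishes outside `[0, t)`, where it is within `ε` of `f`, almost everywhere. -/
def ApproxOn (t : ℝ≥0) (ε : ℝ) (F : L2 k (Ici 0)) (f : ℝ → k) : Prop :=
  ∀ᵐ u : ℝ ∂volume.restrict (Ici 0), (u < t → ‖F u - f u‖ ≤ ε) ∧ ((t : ℝ) ≤ u → F u = 0)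

omit [InnerProductSpace ℂ k] in
theorem approxOn_zero (ε : ℝ) (f : ℝ → k) : ApproxOn 0 ε (stepL2 0 0) f := by
  filter_upwards [stepL2_ae (0 : k) 0, ae_restrict_mem measurableSet_Ici] with u h1 h2
  refine ⟨fun hu => absurd h2 (not_le_of_gt (by simpa using hu)), fun _ => ?_⟩
  rw [h1]; exact ite_self _

theorem ApproxOn.concat_stepL2 {δ t : ℝ≥0} {ε : ℝ} {F : L2 k (Ici 0)} {f : ℝ → k}
    (hf : ∀ u v, |u - v| ≤ (δ : ℝ) → ‖f u - f v‖ ≤ ε) (hF : ApproxOn t ε F fun u => f (u + δ)) :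
    ApproxOn (δ + t) ε (concat δ (stepL2 (f 0) δ) F) f := by
  filter_upwards [concat_ae δ (stepL2 (f 0) δ) F, stepL2_ae (f 0) δ, ae_sub δ hF,
    ae_restrict_mem measurableSet_Ici] with u h1 h2 h3 h4
  rw [h1, h2]
  push_cast
  rcases lt_or_ge u δ with hu | hu
  · rw [if_pos hu, if_pos hu]
    have ht := t.coe_nonneg
    have h4' : 0 ≤ u := h4
    refine ⟨fun _ => hf 0 u ?_, fun hu' => by linarith⟩
    rw [zero_sub, abs_neg, abs_of_nonneg h4']
    exact hu.le
  · rw [if_neg (not_lt.2 hu)]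
    obtain ⟨h5, h6⟩ := h3 hu
    rw [sub_add_cancel] at h5
    exact ⟨fun hu' => h5 (by linarith), fun hu' => h6 (by linarith)⟩

/-- A uniform error `ε` on `[0, t)` costs `ε √t` in `L²`; the factor `√t` is the norm of the step
function `1_{[0, t)}`. -/
theorem ApproxOn.norm_sub_le {t : ℝ≥0} {ε : ℝ} {F f : L2 k (Ici 0)} {φ : ℝ → k}
    (hf : f =ᵐ[volume.restrict (Ici 0)] φ) (hF : ApproxOn t ε F φ) :
    ‖past t f - F‖ ≤ ε * ‖stepL2 (1 : ℂ) t‖ := by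
  refine (Lp.norm_le_mul_norm_of_ae_le_mul ?_)
  filter_upwards [Lp.coeFn_sub (past t f) F, past_ae t f, hf, hF, stepL2_ae (1 : ℂ) t]
    with u h1 h2 h3 h4 h5
  rw [h1, Pi.sub_apply, h2, h5, h3]
  split_ifs with hu
  · rw [norm_one, mul_one, norm_sub_rev]
    exact h4.1 hu
  · rw [h4.2 (not_lt.1 hu)]
    simp

section Induction

variable {P : ℝ≥0 → L2 k (Ici 0) → L2 k (Ici 0) → Prop}

/-- Functions oscillating by at most `ε` on intervals of length `δ` are approximated by step functions
on the grid of mesh `δ`, both on the same grid; the first step is split off and the functions are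
shifted by `δ`. -/
theorem exists_approxOn_pair (hstep : ∀ (c d : k) (t : ℝ≥0), P t (stepL2 c t) (stepL2 d t))
    (hconcat : ∀ (c d : k) (r t : ℝ≥0) (f g : L2 k (Ici 0)), P t f g →
      P (r + t) (concat r (stepL2 c r) f) (concat r (stepL2 d r) g))
    (δ : ℝ≥0) {ε : ℝ} (n : ℕ) (f g : ℝ → k) (hf : ∀ u v, |u - v| ≤ (δ : ℝ) → ‖f u - f v‖ ≤ ε)
    (hg : ∀ u v, |u - v| ≤ (δ : ℝ) → ‖g u - g v‖ ≤ ε) :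
    ∃ F G, P (n * δ) F G ∧ ApproxOn (n * δ) ε F f ∧ ApproxOn (n * δ) ε G g := by
  induction n generalizing f g with
  | zero =>
    rw [Nat.cast_zero, zero_mul]
    exact ⟨_, _, hstep 0 0 0, approxOn_zero _ _, approxOn_zero _ _⟩
  | succ n ih =>
    obtain ⟨F, G, h1, h2, h3⟩ := ih (fun u => f (u + δ)) (fun u => g (u + δ))
      (fun u v huv => hf _ _ (by simpa [add_sub_add_right_eq_sub] using huv)) (fun u v huv => hg _ _ (by simpa [add_sub_add_right_eq_sub] using huv))
    have he : ((n + 1 : ℕ) : ℝ≥0) * δ = δ + n * δ := by push_cast; ring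
    rw [he]
    exact ⟨_, _, hconcat (f 0) (g 0) _ _ _ _ h1, h2.concat_stepL2 hf, h3.concat_stepL2 hg⟩

theorem mem_of_uniformContinuous (hstep : ∀ (c d : k) (t : ℝ≥0), P t (stepL2 c t) (stepL2 d t))
    (hconcat : ∀ (c d : k) (r t : ℝ≥0) (f g : L2 k (Ici 0)), P t f g →
      P (r + t) (concat r (stepL2 c r) f) (concat r (stepL2 d r) g))
    (hclosed : ∀ t, IsClosed {p : L2 k (Ici 0) × L2 k (Ici 0) | P t p.1 p.2})
    (t : ℝ≥0) {f g : L2 k (Ici 0)} {φ γ : ℝ → k} (hφ : UniformContinuous φ)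
    (hγ : UniformContinuous γ) (hf : f =ᵐ[volume.restrict (Ici 0)] φ)
    (hg : g =ᵐ[volume.restrict (Ici 0)] γ) : P t (past t f) (past t g) := by
  have hmem : (past t f, past t g) ∈ closure {p : L2 k (Ici 0) × L2 k (Ici 0) | P t p.1 p.2} := by
    rw [Metric.mem_closure_iff]
    intro ε hε
    obtain ⟨C, hC, hC0⟩ : ∃ C : ℝ, C = ‖stepL2 (1 : ℂ) t‖ ∧ 0 ≤ C := ⟨_, rfl, norm_nonneg _⟩
    obtain ⟨η, hη, hηC⟩ : ∃ η : ℝ, 0 < η ∧ η * C < ε := by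
      refine ⟨ε / (C + 1), by positivity, ?_⟩
      rw [div_mul_eq_mul_div, div_lt_iff₀ (by positivity)]
      nlinarith
    obtain ⟨δ₁, hδ₁, h1⟩ := Metric.uniformContinuous_iff.1 hφ η hη
    obtain ⟨δ₂, hδ₂, h2⟩ := Metric.uniformContinuous_iff.1 hγ η hη
    obtain ⟨n, hn⟩ := exists_nat_gt ((t : ℝ) / min δ₁ δ₂)
    have hmin : 0 < min δ₁ δ₂ := lt_min hδ₁ hδ₂
    have hn0 : (0 : ℝ) < n := lt_of_le_of_lt (by positivity) hn
    have hlt : ((t / n : ℝ≥0) : ℝ) < min δ₁ δ₂ := by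
      rw [div_lt_iff₀ hmin] at hn
      push_cast
      rw [div_lt_iff₀ hn0]
      linarith
    have hnn : (n : ℝ≥0) ≠ 0 := by exact_mod_cast hn0.ne'
    have hmod : ∀ {ψ : ℝ → k} {δ : ℝ}, (∀ ⦃a b : ℝ⦄, dist a b < δ → dist (ψ a) (ψ b) < η) →
        min δ₁ δ₂ ≤ δ → ∀ u v, |u - v| ≤ ((t / n : ℝ≥0) : ℝ) → ‖ψ u - ψ v‖ ≤ η := by
      intro ψ δ hψ hδ u v huv
      rw [← dist_eq_norm]
      exact (hψ (lt_of_le_of_lt huv (hlt.trans_le hδ))).le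
    obtain ⟨F, G, hP, hF, hG⟩ := exists_approxOn_pair hstep hconcat (t / n) n φ γ
      (hmod h1 (min_le_left _ _)) (hmod h2 (min_le_right _ _))
    rw [mul_div_cancel₀ _ hnn] at hP hF hG
    refine ⟨(F, G), hP, ?_⟩
    rw [Prod.dist_eq, dist_eq_norm, dist_eq_norm]
    rw [hC] at hηC
    exact max_lt ((hF.norm_sub_le hf).trans_lt hηC) ((hG.norm_sub_le hg).trans_lt hηC)
  rwa [(hclosed t).closure_eq] at hmem

theorem dense_uniformContinuous : Dense {f : L2 k (Ici 0) | ∃ φ : ℝ → k,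
    UniformContinuous φ ∧ f =ᵐ[volume.restrict (Ici 0)] φ} := by
  intro f
  rw [Metric.mem_closure_iff]
  intro ε hε
  obtain ⟨φ, h1, h2, h3, h4⟩ := (Lp.memLp f).exists_hasCompactSupport_eLpNorm_sub_le
    (ENNReal.ofNat_ne_top) (ε := ENNReal.ofReal (ε / 2)) (by simpa using hε)
  refine ⟨h4.toLp φ, ⟨φ, h1.uniformContinuous_of_continuous h3, h4.coeFn_toLp⟩, ?_⟩
  rw [dist_eq_norm, Lp.norm_def]
  have h5 : eLpNorm (⇑(f - h4.toLp φ)) 2 (volume.restrict (Ici 0)) ≤ ENNReal.ofReal (ε / 2) := by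
    rw [eLpNorm_congr_ae ((Lp.coeFn_sub f (h4.toLp φ)).trans
      (Filter.EventuallyEq.rfl.sub h4.coeFn_toLp))]
    exact h2
  exact (ENNReal.toReal_le_of_le_ofReal (by positivity) h5).trans_lt (by linarith)

/-- A closed relation between square integrable functions on `[0, t)` that contains the pairs of
constants and is stable under putting constants in front of a pair of functions contains all pairs:
a pair of continuous functions is approximated by step functions on a common regular grid. -/
theorem past_induction (hstep : ∀ (c d : k) (t : ℝ≥0), P t (stepL2 c t) (stepL2 d t))
    (hconcat : ∀ (c d : k) (r t : ℝ≥0) (f g : L2 k (Ici 0)), P t f g →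
      P (r + t) (concat r (stepL2 c r) f) (concat r (stepL2 d r) g))
    (hclosed : ∀ t, IsClosed {p : L2 k (Ici 0) × L2 k (Ici 0) | P t p.1 p.2})
    (t : ℝ≥0) (f g : L2 k (Ici 0)) : P t (past t f) (past t g) := by
  have hcont : Continuous fun p : L2 k (Ici 0) × L2 k (Ici 0) => (past t p.1, past t p.2) :=
    ((continuous_past t).comp continuous_fst).prodMk ((continuous_past t).comp continuous_snd)
  exact isClosed_property2 (p := fun f g => P t (past t f) (past t g))
    (dense_uniformContinuous (k := k)).denseRange_val ((hclosed t).preimage hcont)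
    (fun ⟨f, φ, hφ, hf⟩ ⟨g, γ, hγ, hg⟩ =>
      mem_of_uniformContinuous hstep hconcat hclosed t hφ hγ hf hg) f g

end Induction

end StepFunctions

/-! ### Cocycles and their associated semigroups -/

section Cocycles

variable {h : Type u} [NormedAddCommGroup h] [InnerProductSpace ℂ h] [CompleteSpace h]
  {k : Type v} [NormedAddCommGroup k] [InnerProductSpace ℂ k]

theorem IsLeftCocycle.matrixCoeff_concat {X : ℝ≥0 → FockOp h k} (hX : IsLeftCocycle X)
    (c d : k) (r t : ℝ≥0) (f g : L2 k (Ici 0)) :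
    matrixCoeff (X (r + t)) (concat r (stepL2 c r) f) (concat r (stepL2 d r) g) =
      assocSemigroup X c d r * matrixCoeff (X t) f g := by
  rw [hX.add, matrixCoeff_mul_ccrFlow (hX.adapted r), past_concat, past_concat, past_stepL2,
    past_stepL2, future_concat, future_concat, assocSemigroup_eq]

theorem IsRightCocycle.matrixCoeff_concat {X : ℝ≥0 → FockOp h k} (hX : IsRightCocycle X)
    (c d : k) (r t : ℝ≥0) (f g : L2 k (Ici 0)) :
    matrixCoeff (X (r + t)) (concat r (stepL2 c r) f) (concat r (stepL2 d r) g) =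
      matrixCoeff (X t) f g * assocSemigroup X c d r := by
  rw [hX.add, matrixCoeff_ccrFlow_mul (hX.adapted r), past_concat, past_concat, past_stepL2,
    past_stepL2, future_concat, future_concat, assocSemigroup_eq]

theorem eq_of_matrixCoeff_past {t : ℝ≥0} {S T : FockOp h k} (hS : IsAdapted t S)
    (hT : IsAdapted t T)
    (hST : ∀ f g, matrixCoeff S (past t f) (past t g) = matrixCoeff T (past t f) (past t g)) :
    S = T :=
  matrixCoeff_ext fun f g => by
    rw [(isAdapted_iff_matrixCoeff t S).1 hS, (isAdapted_iff_matrixCoeff t T).1 hT, hST]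

/-- A left cocycle is determined by its associated semigroups. -/
theorem IsLeftCocycle.eq_of_assocSemigroup_eq {X Y : ℝ≥0 → FockOp h k} (hX : IsLeftCocycle X)
    (hY : IsLeftCocycle Y)
    (hXY : ∀ (c d : k) (t : ℝ≥0), assocSemigroup X c d t = assocSemigroup Y c d t) : X = Y := by
  funext t
  refine eq_of_matrixCoeff_past (hX.adapted t) (hY.adapted t) fun f g => ?_
  refine past_induction (P := fun t f g => matrixCoeff (X t) f g = matrixCoeff (Y t) f g)
    hXY (fun c d r t f g hfg => ?_) (fun t => ?_) t f g
  · rw [hX.matrixCoeff_concat, hY.matrixCoeff_concat, hXY, hfg]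
  · exact isClosed_eq (continuous_matrixCoeff _) (continuous_matrixCoeff _)

/-- A right cocycle is determined by its associated semigroups, as its adjoint is a left cocycle. -/
theorem IsRightCocycle.eq_of_assocSemigroup_eq {X Y : ℝ≥0 → FockOp h k} (hX : IsRightCocycle X)
    (hY : IsRightCocycle Y)
    (hXY : ∀ (c d : k) (t : ℝ≥0), assocSemigroup X c d t = assocSemigroup Y c d t) : X = Y := by
  have key := hX.isLeftCocycle_adjointProcess.eq_of_assocSemigroup_eq
      hY.isLeftCocycle_adjointProcess fun c d t => by
    rw [assocSemigroup_adjointProcess, assocSemigroup_adjointProcess, hXY]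
  funext t
  exact star_injective (congrFun key t)

theorem assocSemigroup_mem_cptAlgebra (X : ℝ≥0 → FockOp h k) (c d : k) (t : ℝ≥0) :
    assocSemigroup X c d t ∈ cptAlgebra X :=
  Subalgebra.le_topologicalClosure _ (Algebra.subset_adjoin ⟨c, d, t, rfl⟩)

/-- On step functions the coefficient of `X_t` is a product of the generators of `A_X`; the general
case follows by density, since `A_X` is norm closed. -/
theorem IsLeftCocycle.matrixCoeff_past_mem {X : ℝ≥0 → FockOp h k} (hX : IsLeftCocycle X)
    (t : ℝ≥0) (f g : L2 k (Ici 0)) : matrixCoeff (X t) (past t f) (past t g) ∈ cptAlgebra X := by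
  refine past_induction (P := fun t f g => matrixCoeff (X t) f g ∈ cptAlgebra X)
    (assocSemigroup_mem_cptAlgebra X) (fun c d r t f g hfg => ?_) (fun t => ?_) t f g
  · rw [hX.matrixCoeff_concat]
    exact mul_mem (assocSemigroup_mem_cptAlgebra X c d r) hfg
  · exact (Subalgebra.isClosed_topologicalClosure _).preimage (continuous_matrixCoeff (X t))

theorem IsLeftCocycle.matrixCoeff_mem {X : ℝ≥0 → FockOp h k} (hX : IsLeftCocycle X)
    (t : ℝ≥0) (f g : L2 k (Ici 0)) : matrixCoeff (X t) f g ∈ cptAlgebra X := by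
  rw [(isAdapted_iff_matrixCoeff t _).1 (hX.adapted t)]
  exact Subalgebra.smul_mem _ (hX.matrixCoeff_past_mem t f g) _

theorem IsLeftCocycle.isRightCocycle_iff_eq_reversed {X : ℝ≥0 → FockOp h k}
    (hX : IsLeftCocycle X) : IsRightCocycle X ↔ X = reversed X := by
  refine ⟨fun hR => hR.eq_of_assocSemigroup_eq hX.isRightCocycle_reversed fun c d t =>
    (assocSemigroup_reversed X c d t).symm, fun he => ?_⟩
  rw [he]
  exact hX.isRightCocycle_reversed

theorem IsLeftCocycle.isRightCocycle_iff_commute {X : ℝ≥0 → FockOp h k} (hX : IsLeftCocycle X) :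
    IsRightCocycle X ↔ ∀ S ∈ cptAlgebra X, ∀ T ∈ cptAlgebra X, S * T = T * S := by
  constructor
  · intro hR
    have hgen : ∀ (c d c' d' : k) (r t : ℝ≥0), assocSemigroup X c d r * assocSemigroup X c' d' t =
        assocSemigroup X c' d' t * assocSemigroup X c d r := by
      intro c d c' d' r t
      rw [assocSemigroup_eq X c' d' t, ← hX.matrixCoeff_concat, ← hR.matrixCoeff_concat]
    have hle := Subalgebra.topologicalClosure_adjoin_le_centralizer_centralizer (R := ℂ)
      {T | ∃ (c d : k) (t : ℝ≥0), T = assocSemigroup X c d t}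
    intro S hS T hT
    refine Set.centralizer_centralizer_comm_of_comm ?_ S (hle hS) T (hle hT)
    rintro _ ⟨c, d, r, rfl⟩ _ ⟨c', d', t, rfl⟩
    exact hgen c d c' d' r t
  · intro hcomm
    refine ⟨hX.adapted, hX.zero, fun r t => matrixCoeff_ext fun f g => ?_⟩
    rw [matrixCoeff_ccrFlow_mul (hX.adapted r), hX.add, matrixCoeff_mul_ccrFlow (hX.adapted r)]
    exact hcomm _ (hX.matrixCoeff_mem _ _ _) _ (hX.matrixCoeff_mem _ _ _)

theorem IsLeftCocycle.adjointProcess_eq_reversed_iff {X : ℝ≥0 → FockOp h k}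
    (hX : IsLeftCocycle X) : adjointProcess X = reversed X ↔
      ∀ (c d : k) (t : ℝ≥0),
        ContinuousLinearMap.adjoint (assocSemigroup X c d t) = assocSemigroup X d c t := by
  constructor
  · intro he c d t
    rw [← assocSemigroup_adjointProcess, he, assocSemigroup_reversed]
  · intro hQ
    refine hX.isRightCocycle_adjointProcess.eq_of_assocSemigroup_eq
      hX.isRightCocycle_reversed fun c d t => ?_
    rw [assocSemigroup_adjointProcess, assocSemigroup_reversed, hQ]

theorem adjoint_mem_cptAlgebra {X : ℝ≥0 → FockOp h k}
    (hQ : ∀ (c d : k) (t : ℝ≥0),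
      ContinuousLinearMap.adjoint (assocSemigroup X c d t) = assocSemigroup X d c t)
    {T : h →L[ℂ] h} (hT : T ∈ cptAlgebra X) : ContinuousLinearMap.adjoint T ∈ cptAlgebra X := by
  refine map_mem_closure ContinuousLinearMap.adjoint.continuous hT fun S hS => ?_
  induction hS using Algebra.adjoin_induction with
  | mem S hS =>
    obtain ⟨c, d, t, rfl⟩ := hS
    rw [hQ]
    exact Algebra.subset_adjoin ⟨d, c, t, rfl⟩
  | algebraMap z =>
    rw [← ContinuousLinearMap.star_eq_adjoint, ← algebraMap_star_comm]
    exact Subalgebra.algebraMap_mem _ _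
  | add S T _ _ hS hT =>
    rw [map_add]
    exact add_mem hS hT
  | mul S T _ _ hS hT =>
    rw [← ContinuousLinearMap.star_eq_adjoint, star_mul]
    exact mul_mem hT hS

/-- The double commutant taken among star subalgebras is a plain double commutant, as the commutant
of a self-adjoint set is self-adjoint. -/
theorem mem_vonNeumannGenerated_iff {S : Set (h →L[ℂ] h)} {T : h →L[ℂ] h} :
    T ∈ vonNeumannGenerated S ↔ T ∈ (S ∪ star S).centralizer.centralizer := by
  rw [← StarSubalgebra.coe_centralizer_centralizer ℂ]
  rfl

theorem mem_cptVonNeumann_of_mem_cptAlgebra {X : ℝ≥0 → FockOp h k} {T : h →L[ℂ] h}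
    (hT : T ∈ cptAlgebra X) : T ∈ cptVonNeumann X :=
  mem_vonNeumannGenerated_iff.2 (Set.subset_centralizer_centralizer (Or.inl hT))

theorem cptVonNeumann_commute {X : ℝ≥0 → FockOp h k}
    (hstar : ∀ T ∈ cptAlgebra X, ContinuousLinearMap.adjoint T ∈ cptAlgebra X)
    (hcomm : ∀ S ∈ cptAlgebra X, ∀ T ∈ cptAlgebra X, S * T = T * S) :
    ∀ S ∈ cptVonNeumann X, ∀ T ∈ cptVonNeumann X, S * T = T * S := by
  have hsub : ∀ T ∈ (cptAlgebra X : Set (h →L[ℂ] h)) ∪ star (cptAlgebra X : Set (h →L[ℂ] h)),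
      T ∈ cptAlgebra X := by
    rintro T (hT | hT)
    · exact hT
    · rw [← star_star T]
      exact hstar _ hT
  intro S hS T hT
  exact Set.centralizer_centralizer_comm_of_comm
    (fun A hA B hB => hcomm A (hsub A hA) B (hsub B hB))
    S (mem_vonNeumannGenerated_iff.1 hS) T (mem_vonNeumannGenerated_iff.1 hT)

end Cocycles

end FockCocycle

theorem proposition2p4
    {h : Type*} [NormedAddCommGroup h] [InnerProductSpace ℂ h] [CompleteSpace h]
    {k : Type*} [NormedAddCommGroup k] [InnerProductSpace ℂ k] [CompleteSpace k]
    (X : ℝ≥0 → FockOp h k) (hX : IsLeftCocycle X) :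
    -- part (a)
    ((IsRightCocycle X ↔ X = reversed X) ∧
      (X = reversed X ↔ ∀ S ∈ cptAlgebra X, ∀ T ∈ cptAlgebra X, S * T = T * S)) ∧
    -- part (b)
    ((adjointProcess X = reversed X ↔
        ∀ (c d : k) (t : ℝ≥0),
          ContinuousLinearMap.adjoint (assocSemigroup X c d t) = assocSemigroup X d c t) ∧
      (adjointProcess X = reversed X →
        ∀ T ∈ cptAlgebra X, ContinuousLinearMap.adjoint T ∈ cptAlgebra X)) ∧
    -- part (c)
    (((∀ t, IsSelfAdjoint (X t)) ↔
        (∀ (c d : k) (t : ℝ≥0),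
          ContinuousLinearMap.adjoint (assocSemigroup X c d t) = assocSemigroup X d c t) ∧
        ∀ S ∈ cptVonNeumann X, ∀ T ∈ cptVonNeumann X, S * T = T * S) ∧
      ((∀ t, IsSelfAdjoint (X t)) → X = reversed X)) := by
  have hb := hX.adjointProcess_eq_reversed_iff
  have ha := hX.isRightCocycle_iff_eq_reversed
  have hc := hX.isRightCocycle_iff_commute
  have hsa : (∀ t, IsSelfAdjoint (X t)) → adjointProcess X = X := fun hs => funext hs
  have hrev : (∀ t, IsSelfAdjoint (X t)) → X = reversed X := fun hs => by
    refine ha.1 ?_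
    rw [← hsa hs]
    exact hX.isRightCocycle_adjointProcess
  refine ⟨⟨ha, ha.symm.trans hc⟩, ⟨hb, fun he T hT => adjoint_mem_cptAlgebra (hb.1 he) hT⟩,
    ⟨fun hs => ?_, fun hQ t => ?_⟩, hrev⟩
  · have hQ := hb.1 ((hsa hs).trans (hrev hs))
    exact ⟨hQ, cptVonNeumann_commute (fun T hT => adjoint_mem_cptAlgebra hQ hT)
      (hc.1 (ha.2 (hrev hs)))⟩
  · have hr : X = reversed X := ha.1 (hc.2 fun S hS T hT =>
      hQ.2 S (mem_cptVonNeumann_of_mem_cptAlgebra hS) T (mem_cptVonNeumann_of_mem_cptAlgebra hT))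
    exact congrFun ((hb.2 hQ.1).trans hr.symm) t
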